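/- Let $M$ be a connected (Hausdorff) smooth surface. A symbol $\sigma\in\Sigma_4(M)$ is a smooth section of $S^4(TM)$; in local coordinates $x,y$ it reads $$\sigma=a_0\,\partial_x^4+4a_1\,\partial_x^3\cdot\partial_y+6a_2\,\partial_x^2\cdot\partial_y^2+4a_3\,\partial_x\cdot\partial_y^3+a_4\,\partial_y^4$$ with smooth functions $a_i$, where $\cdot$ is the symmetric product. It is called regular if at every point the discriminant of the binary quartic $a_0s^4+4a_1s^3t+6a_2s^2t^2+4a_3st^3+a_4t^4$ is nonzero. A Wagner connection of $\sigma$ is a smooth linear connection $\nabla$ in the tangent bundle $TM$ such that $\nabla_X\sigma=0$ for all vector fields $X$. A symbol $\sigma$ on $M$ is locally equivalent to a symbol $\tau$ on $\mathbb R^2$ if every point of $M$ has an open neighbourhood $U$ and a diffeomorphism $\varphi$ of $U$ onto an open subset of $\mathbb R^2$ with $\varphi_*(\sigma|_U)=\tau|_{\varphi(U)}$. **Theorem.** Let $\sigma\in\Sigma_4(M)$ be a regular symbol, let $\nabla$ be a Wagner connection of $\sigma$, and assume that its torsion tensor $T$ is parallel, i.e. $\nabla T=0$. Let $x,y$ be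 the standard coordinates on $\mathbb R^2$. Then: 1. There are constants $c_0,\dots,c_4\in\mathbb R$ such that $\sigma$ is locally equivalent to $$c_0\,\partial_x^4+4c_1\,\partial_x^3\cdot\partial_y+6c_2\,\partial_x^2\cdot\partial_y^2+4c_3\,\partial_x\cdot\partial_y^3+c_4\,\partial_y^4$$ if and only if $T=0$. 2. There are constants $c_0,\dots,c_4\in\mathbb R$ such that $\sigma$ is locally equivalent to $$c_0e^{4y}\,\partial_x^4+4c_1e^{3y}\,\partial_x^3\cdot\partial_y+6c_2e^{2y}\,\partial_x^2\cdot\partial_y^2+4c_3e^{y}\,\partial_x\cdot\partial_y^3+c_4\,\partial_y^4$$ if and only if $T\neq 0$ (i.e. $T$ does not vanish identically). -/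

import Mathlib

open scoped Manifold ContDiff Bundle

noncomputable section

namespace QuarticSymbol

/-- The coordinate plane `ℝ²`, with coordinates `x = z 0` and `y = z 1`. -/
abbrev Plane : Type := EuclideanSpace ℝ (Fin 2)

/-- The space `S⁴(V)` of symmetric 4-vectors over a finite-dimensional space `V`, realised as the
space of symmetric 4-linear forms on the dual space `V*`. -/
structure FourVector (V : Type*) [AddCommGroup V] [Module ℝ V] [TopologicalSpace V]
    [IsTopologicalAddGroup V] [ContinuousSMul ℝ V] where
  /-- The underlying 4-linear form on covectors. -/
  form : MultilinearMap ℝ (fun _ : Fin 4 ↦ V →L[ℝ] ℝ) ℝ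
  symm : ∀ (ρ : Equiv.Perm (Fin 4)) (α : Fin 4 → (V →L[ℝ] ℝ)), form (α ∘ ρ) = form α

/-- The symmetric product `v₀ · v₁ · v₂ · v₃`, as a 4-linear form on covectors: it is normalised so
that its value on `(ξ, ξ, ξ, ξ)` is `ξ(v₀) ξ(v₁) ξ(v₂) ξ(v₃)`. -/
def symProd {V : Type*} [AddCommGroup V] [Module ℝ V] [TopologicalSpace V]
    [IsTopologicalAddGroup V] [ContinuousSMul ℝ V] (v : Fin 4 → V) :
    MultilinearMap ℝ (fun _ : Fin 4 ↦ V →L[ℝ] ℝ) ℝ :=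
  (1 / 24 : ℝ) • ∑ ρ : Equiv.Perm (Fin 4),
    (MultilinearMap.mkPiAlgebra ℝ (Fin 4) ℝ).compLinearMap
      (fun i ↦ { toFun := fun ξ ↦ ξ (v (ρ i)), map_add' := by simp, map_smul' := by simp })

lemma symProd_apply {V : Type*} [AddCommGroup V] [Module ℝ V] [TopologicalSpace V]
    [IsTopologicalAddGroup V] [ContinuousSMul ℝ V] (v : Fin 4 → V) (α : Fin 4 → (V →L[ℝ] ℝ)) :
    symProd v α = (1 / 24 : ℝ) * ∑ ρ : Equiv.Perm (Fin 4), ∏ i, α i (v (ρ i)) := by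
  simp [symProd]

lemma symProd_symm {V : Type*} [AddCommGroup V] [Module ℝ V] [TopologicalSpace V]
    [IsTopologicalAddGroup V] [ContinuousSMul ℝ V] (v : Fin 4 → V) (τ : Equiv.Perm (Fin 4))
    (α : Fin 4 → (V →L[ℝ] ℝ)) : symProd v (α ∘ τ) = symProd v α := by
  rw [symProd_apply, symProd_apply]
  congr 1
  refine Fintype.sum_equiv (Equiv.mulRight τ⁻¹) _ _ fun ρ ↦ ?_
  refine Fintype.prod_equiv τ _ _ fun i ↦ ?_
  simp

/-- The symmetric 4-vector `a₀ v⁴ + 4 a₁ v³·w + 6 a₂ v²·w² + 4 a₃ v·w³ + a₄ w⁴`. -/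
def FourVector.ofCoeffs {V : Type*} [AddCommGroup V] [Module ℝ V] [TopologicalSpace V]
    [IsTopologicalAddGroup V] [ContinuousSMul ℝ V] (a : Fin 5 → ℝ) (v w : V) : FourVector V where
  form := a 0 • symProd ![v, v, v, v] + (4 * a 1) • symProd ![v, v, v, w]
    + (6 * a 2) • symProd ![v, v, w, w] + (4 * a 3) • symProd ![v, w, w, w]
    + a 4 • symProd ![w, w, w, w]
  symm ρ α := by
    simp only [add_apply, smul_apply, symProd_symm]

/-- The discriminant of the binary quartic `a₀ s⁴ + 4 a₁ s³ t + 6 a₂ s² t² + 4 a₃ s t³ + a₄ t⁴`,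
expressed through its classical invariants of degrees two and three. -/
def quarticDiscr (a : Fin 5 → ℝ) : ℝ :=
  256 * ((a 0 * a 4 - 4 * a 1 * a 3 + 3 * a 2 ^ 2) ^ 3
    - 27 * (a 0 * a 2 * a 4 - a 0 * a 3 ^ 2 - a 1 ^ 2 * a 4 + 2 * a 1 * a 2 * a 3 - a 2 ^ 3) ^ 2)

/-- The coefficients `a₀, …, a₄` of the binary quartic
`(s, t) ↦ S(sξ + tη, sξ + tη, sξ + tη, sξ + tη)`. -/
def FourVector.coeffs {V : Type*} [AddCommGroup V] [Module ℝ V] [TopologicalSpace V]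
    [IsTopologicalAddGroup V] [ContinuousSMul ℝ V] (S : FourVector V) (ξ η : V →L[ℝ] ℝ) :
    Fin 5 → ℝ :=
  ![S.form ![ξ, ξ, ξ, ξ], S.form ![ξ, ξ, ξ, η], S.form ![ξ, ξ, η, η], S.form ![ξ, η, η, η],
    S.form ![η, η, η, η]]

/-- A symmetric 4-vector on a plane is regular if its discriminant does not vanish. The discriminant
in one basis of the dual plane is a nonzero multiple of that in any other basis. -/
def FourVector.IsRegular {V : Type*} [AddCommGroup V] [Module ℝ V] [TopologicalSpace V]
    [IsTopologicalAddGroup V] [ContinuousSMul ℝ V] (S : FourVector V) : Prop :=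
  ∀ ξ η : V →L[ℝ] ℝ, LinearIndependent ℝ ![ξ, η] → quarticDiscr (S.coeffs ξ η) ≠ 0

section Surface

variable {M : Type*} [TopologicalSpace M] [ChartedSpace Plane M] [IsManifold (𝓡 2) ∞ M]

/-- The vector field `Y` is differentiable at `p`. -/
def DiffVectorAt (Y : (q : M) → TangentSpace (𝓡 2) q) (p : M) : Prop :=
  MDifferentiableAt (𝓡 2) ((𝓡 2).prod 𝓘(ℝ, Plane))
    (fun q ↦ Bundle.TotalSpace.mk' Plane (E := fun q : M ↦ TangentSpace (𝓡 2) q) q (Y q)) p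

/-- The covector field `α` is differentiable at `p`. -/
def DiffCovectorAt (α : (q : M) → (TangentSpace (𝓡 2) q →L[ℝ] ℝ)) (p : M) : Prop :=
  MDifferentiableAt (𝓡 2) ((𝓡 2).prod 𝓘(ℝ, Plane →L[ℝ] ℝ))
    (fun q ↦ Bundle.TotalSpace.mk' (Plane →L[ℝ] ℝ)
      (E := fun q : M ↦ TangentSpace (𝓡 2) q →L[ℝ] Bundle.Trivial M ℝ q) q (α q)) p

/-- The covector field `α` is `C^∞` at `p`. -/
def SmoothCovectorAt (α : (q : M) → (TangentSpace (𝓡 2) q →L[ℝ] ℝ)) (p : M) : Prop :=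
  ContMDiffAt (𝓡 2) ((𝓡 2).prod 𝓘(ℝ, Plane →L[ℝ] ℝ)) ∞
    (fun q ↦ Bundle.TotalSpace.mk' (Plane →L[ℝ] ℝ)
      (E := fun q : M ↦ TangentSpace (𝓡 2) q →L[ℝ] Bundle.Trivial M ℝ q) q (α q)) p

lemma DiffCovectorAt.apply {α : (q : M) → (TangentSpace (𝓡 2) q →L[ℝ] ℝ)} {p : M}
    (hα : DiffCovectorAt α p) {Y : (q : M) → TangentSpace (𝓡 2) q} (hY : DiffVectorAt Y p) :
    MDifferentiableAt (𝓡 2) 𝓘(ℝ, ℝ) (fun q ↦ α q (Y q)) p := by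
  have h := MDifferentiableAt.clm_bundle_apply (F₁ := Plane) (F₂ := ℝ)
    (E₁ := fun q : M ↦ TangentSpace (𝓡 2) q) (E₂ := Bundle.Trivial M ℝ) (b := fun q : M ↦ q)
    (ϕ := α) (v := Y) hα hY
  exact ((mdifferentiableAt_section (IB := 𝓡 2) (F := ℝ) (E := Bundle.Trivial M ℝ)
    (s := fun q ↦ α q (Y q))).1 h).congr_of_eventuallyEq (by simp)

variable (M) in
/-- A symbol `σ ∈ Σ₄(M)`: a smooth field of symmetric 4-vectors on `M`. Smoothness means that its
values on smooth covector fields are smooth functions. -/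
structure Symbol where
  /-- The symmetric 4-vector at each point. -/
  val : (p : M) → FourVector (TangentSpace (𝓡 2) p)
  smooth : ∀ (p : M) (α : Fin 4 → (q : M) → (TangentSpace (𝓡 2) q →L[ℝ] ℝ)),
    (∀ i, SmoothCovectorAt (α i) p) →
      ContMDiffAt (𝓡 2) 𝓘(ℝ, ℝ) ∞ (fun q ↦ (val q).form (fun i ↦ α i q)) p

/-- A symbol is regular if it is regular at each point. -/
def Symbol.IsRegular (σ : Symbol M) : Prop := ∀ p, (σ.val p).IsRegular

/-- A linear connection on `M`, i.e. a connection in the tangent bundle. For such a connection `D`,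
a vector field `Y` and a tangent vector `v` at `p`, the vector `∇_v Y` is `D Y p v`. -/
abbrev LinearConnection (M : Type*) [TopologicalSpace M] [ChartedSpace Plane M]
    [IsManifold (𝓡 2) ∞ M] : Type _ :=
  CovariantDerivative (𝓡 2) Plane (fun p : M ↦ TangentSpace (𝓡 2) p)

lemma covector_tensorial (D : LinearConnection M)
    {α : (q : M) → (TangentSpace (𝓡 2) q →L[ℝ] ℝ)} {p : M} (hα : DiffCovectorAt α p)
    (v : TangentSpace (𝓡 2) p) :
    TensorialAt (𝓡 2) Plane (fun Y : (q : M) → TangentSpace (𝓡 2) q ↦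
      mvfderiv (𝓡 2) (fun q ↦ α q (Y q)) p v - α p (D Y p v)) p where
  smul {f Y} hf hY := by
    have h1 : (fun q ↦ α q ((f • Y) q)) = f * fun q ↦ α q (Y q) := by
      ext q; simp
    rw [h1, mvfderiv_mul hf (hα.apply hY), D.isCovariantDerivativeOnUniv.leibniz hY hf]
    simp
    ring
  add {Y Z} hY hZ := by
    have h1 : (fun q ↦ α q ((Y + Z) q)) = (fun q ↦ α q (Y q)) + fun q ↦ α q (Z q) := by
      ext q; simp
    rw [h1, mvfderiv_add (hα.apply hY) (hα.apply hZ), D.isCovariantDerivativeOnUniv.add hY hZ]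
    simp
    ring

open scoped Classical in
/-- The dual connection on covector fields: for `α` differentiable at `p`, `∇_v α` is the covector
at `p` with `(∇_v α)(Y) = v(α(Y)) - α(∇_v Y)` for every vector field `Y` differentiable at `p`. -/
def covectorDeriv (D : LinearConnection M) (α : (q : M) → (TangentSpace (𝓡 2) q →L[ℝ] ℝ)) (p : M)
    (v : TangentSpace (𝓡 2) p) : TangentSpace (𝓡 2) p →L[ℝ] ℝ :=
  if hα : DiffCovectorAt α p then TensorialAt.mkHom _ p (covector_tensorial D hα v) else 0

lemma covectorDeriv_apply (D : LinearConnection M)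
    {α : (q : M) → (TangentSpace (𝓡 2) q →L[ℝ] ℝ)} {p : M} (hα : DiffCovectorAt α p)
    (v : TangentSpace (𝓡 2) p) {Y : (q : M) → TangentSpace (𝓡 2) q} (hY : DiffVectorAt Y p) :
    covectorDeriv D α p v (Y p) = mvfderiv (𝓡 2) (fun q ↦ α q (Y q)) p v - α p (D Y p v) := by
  rw [covectorDeriv, dif_pos hα]
  exact TensorialAt.mkHom_apply (covector_tensorial D hα v) hY

/-- The value `(∇_v σ)(α₀, α₁, α₂, α₃)` of the covariant derivative of the symbol `σ`. -/
def Symbol.covDeriv (D : LinearConnection M) (σ : Symbol M) (p : M) (v : TangentSpace (𝓡 2) p)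
    (α : Fin 4 → (q : M) → (TangentSpace (𝓡 2) q →L[ℝ] ℝ)) : ℝ :=
  mvfderiv (𝓡 2) (fun q ↦ (σ.val q).form (fun i ↦ α i q)) p v
    - ∑ i, (σ.val p).form (Function.update (fun j ↦ α j p) i (covectorDeriv D (α i) p v))

/-- The connection `D` is a Wagner connection of the symbol `σ`: `∇_X σ = 0` for all vector fields
`X`. -/
def Symbol.IsWagnerConnection (σ : Symbol M) (D : LinearConnection M) : Prop :=
  ∀ (p : M) (v : TangentSpace (𝓡 2) p) (α : Fin 4 → (q : M) → (TangentSpace (𝓡 2) q →L[ℝ] ℝ)),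
    (∀ i, DiffCovectorAt (α i) p) → σ.covDeriv D p v α = 0

/-- The torsion tensor `T` of the connection `D` is parallel:
`(∇_v T)(Y, Z) = ∇_v (T(Y, Z)) - T(∇_v Y, Z) - T(Y, ∇_v Z) = 0`. -/
def HasParallelTorsion (D : LinearConnection M) : Prop :=
  ∀ (p : M) (v : TangentSpace (𝓡 2) p) (Y Z : (q : M) → TangentSpace (𝓡 2) q),
    DiffVectorAt Y p → DiffVectorAt Z p →
      D (fun q ↦ D.torsion q (Y q) (Z q)) p v
        - D.torsion p (D Y p v) (Z p) - D.torsion p (Y p) (D Z p v) = 0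

/-- The symbol `σ` on `M` is locally equivalent to the symbol `τ` on `N`: every point of `M` has an
open neighbourhood with a diffeomorphism `φ` onto an open subset of `N` such that `φ_* σ = τ`. -/
def Symbol.LocallyEquivalent {N : Type*} [TopologicalSpace N] [ChartedSpace Plane N]
    [IsManifold (𝓡 2) ∞ N] (σ : Symbol M) (τ : Symbol N) : Prop :=
  ∀ p : M, ∃ φ : OpenPartialHomeomorph M N, p ∈ φ.source ∧
    ContMDiffOn (𝓡 2) (𝓡 2) ∞ φ φ.source ∧ ContMDiffOn (𝓡 2) (𝓡 2) ∞ φ.symm φ.target ∧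
    ∀ q ∈ φ.source, ∀ α : Fin 4 → (TangentSpace (𝓡 2) (φ q) →L[ℝ] ℝ),
      (τ.val (φ q)).form α
        = (σ.val q).form (fun i ↦ (α i).comp (mfderiv (𝓡 2) (𝓡 2) φ q))

end Surface

section Models

/-- The coordinate vector field `∂_x` (for `i = 0`) or `∂_y` (for `i = 1`) on the plane. -/
def partialField (i : Fin 2) (z : Plane) : TangentSpace (𝓡 2) z :=
  (EuclideanSpace.single i (1 : ℝ) : Plane)

lemma SmoothCovectorAt.apply_partialField
    {α : (z : Plane) → (TangentSpace (𝓡 2) z →L[ℝ] ℝ)} {p : Plane}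
    (hα : SmoothCovectorAt α p) (i : Fin 2) :
    ContMDiffAt (𝓡 2) 𝓘(ℝ, ℝ) ∞ (fun z ↦ α z (partialField i z)) p := by
  have hY : ContMDiffAt (𝓡 2) ((𝓡 2).prod 𝓘(ℝ, Plane)) ∞
      (fun q ↦ Bundle.TotalSpace.mk' Plane (E := fun q : Plane ↦ TangentSpace (𝓡 2) q) q
        (partialField i q)) p := by
    rw [Bundle.contMDiffAt_section]
    simpa [partialField] using contMDiffAt_const
  have h := ContMDiffAt.clm_bundle_apply (F₁ := Plane) (F₂ := ℝ)
    (E₁ := fun q : Plane ↦ TangentSpace (𝓡 2) q) (E₂ := Bundle.Trivial Plane ℝ)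
    (b := fun q : Plane ↦ q) (ϕ := α) (v := partialField i) hα hY
  exact ((Bundle.contMDiffAt_section (IB := 𝓡 2) (F := ℝ) (E := Bundle.Trivial Plane ℝ)
    (s := fun q ↦ α q (partialField i q)) p).1 h).congr_of_eventuallyEq (by simp)

lemma smooth_symProd {α : Fin 4 → (z : Plane) → (TangentSpace (𝓡 2) z →L[ℝ] ℝ)} {p : Plane}
    (hα : ∀ i, SmoothCovectorAt (α i) p) (k : Fin 4 → Fin 2) :
    ContMDiffAt (𝓡 2) 𝓘(ℝ, ℝ) ∞
      (fun z ↦ symProd (fun j ↦ partialField (k j) z) (fun i ↦ α i z)) p := by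
  simp only [symProd_apply]
  refine contMDiffAt_const.mul (contMDiffAt_finsetSum fun ρ _ ↦ contMDiffAt_finsetProd fun i _ ↦ ?_)
  exact (hα i).apply_partialField _

/-- The symbol `a₀ ∂_x⁴ + 4 a₁ ∂_x³·∂_y + 6 a₂ ∂_x²·∂_y² + 4 a₃ ∂_x·∂_y³ + a₄ ∂_y⁴` on the plane
with smooth coefficient functions `a₀, …, a₄`. -/
def Symbol.ofCoeffs (a : Fin 5 → Plane → ℝ) (ha : ∀ k, ContDiff ℝ ∞ (a k)) : Symbol Plane where
  val z := FourVector.ofCoeffs (fun k ↦ a k z) (partialField 0 z) (partialField 1 z)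
  smooth p α hα := by
    have hs (k : Fin 4 → Fin 2) := smooth_symProd hα k
    have ha' (k : Fin 5) : ContMDiffAt (𝓡 2) 𝓘(ℝ, ℝ) ∞ (a k) p := (ha k).contMDiff.contMDiffAt
    have e (k : Fin 4 → Fin 2) (z : Plane) : (fun j ↦ partialField (k j) z)
        = ![partialField (k 0) z, partialField (k 1) z, partialField (k 2) z,
            partialField (k 3) z] := by
      ext j; fin_cases j <;> rfl
    simp only [e] at hs
    have h0 := (ha' 0).mul (hs ![0, 0, 0, 0])
    have h1 := ((contMDiffAt_const (c := (4 : ℝ))).mul (ha' 1)).mul (hs ![0, 0, 0, 1])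
    have h2 := ((contMDiffAt_const (c := (6 : ℝ))).mul (ha' 2)).mul (hs ![0, 0, 1, 1])
    have h3 := ((contMDiffAt_const (c := (4 : ℝ))).mul (ha' 3)).mul (hs ![0, 1, 1, 1])
    have h4 := (ha' 4).mul (hs ![1, 1, 1, 1])
    exact (((h0.add h1).add h2).add h3).add h4

/-- The symbol `c₀ ∂_x⁴ + 4 c₁ ∂_x³·∂_y + 6 c₂ ∂_x²·∂_y² + 4 c₃ ∂_x·∂_y³ + c₄ ∂_y⁴` on the plane,
with constant coefficients. -/
def constantSymbol (c : Fin 5 → ℝ) : Symbol Plane :=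
  Symbol.ofCoeffs (fun k _ ↦ c k) fun _ ↦ contDiff_const

/-- The symbol `c₀ e^{4y} ∂_x⁴ + 4 c₁ e^{3y} ∂_x³·∂_y + 6 c₂ e^{2y} ∂_x²·∂_y² + 4 c₃ e^y ∂_x·∂_y³
+ c₄ ∂_y⁴` on the plane. -/
def exponentialSymbol (c : Fin 5 → ℝ) : Symbol Plane :=
  Symbol.ofCoeffs
    (fun k z ↦ ![c 0 * Real.exp (4 * z 1), c 1 * Real.exp (3 * z 1), c 2 * Real.exp (2 * z 1),
      c 3 * Real.exp (z 1), c 4] k)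
    fun k ↦ by fin_cases k <;> simp <;> fun_prop

end Models

end QuarticSymbol

end

/-! The mechanism is rigidity: a binary quartic with nonzero discriminant has trivial infinitesimal
stabilizer in `gl₂` (`eq_zero_of_quarticDiscr_ne_zero`). Since `∇σ = 0`, the coefficients of `σ` in
a moving coframe `θ` vary only through the action of `∇θ` on the quartic
(`fderiv_coeffs_coordSymbol`). A coframe in which `σ` has constant coefficients is therefore
parallel. Five coefficients depend on the four components of a coframe, so the implicit function
theorem can fix only a suitable projection of them to four dimensions. Rigidity, which persists near
the base point, makes this enough for `∇θ = 0` (`exists_parallelCoframe`). In particular `∇` is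
flat, and in a parallel coframe all five coefficients turn out to be constant
(`ParallelCoframe.coeffs_const`).

For a parallel coframe the first structure equation reads `θ_j ∘ T = dθ_j`, and `∇T = 0` means that
`dθ_j = t_j θ₀ ∧ θ₁` with constants `t_j` (`ParallelCoframe.exists_curl_eq`). A constant change of
coframe brings this to `dθ₀ = ε θ₀ ∧ θ₁`, `dθ₁ = 0` with `ε = 0` or `ε = 1` (`exists_adaptedAt`).
Then `θ₁ = dy` and `e^{εy} θ₀ = dx` locally by the Poincaré lemma, and the coefficients of `σ` in
`dx, dy` are `c_k e^{(4-k)εy}`: these are the two models. Connectedness allows the same `ε` and `c`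
at every point (`adaptedAt_of_preconnectedSpace`).

Conversely, an equivalence with a model pulls back `e^{-εy} dx, dy` to a coframe in which `σ` has
constant coefficients. By rigidity it is parallel, and its exterior derivative exhibits the torsion:
zero for `ε = 0`, nowhere zero for `ε = 1`. The two models thus exclude each other, and both
equivalences follow. -/

open Function Set Filter Topology

noncomputable section

namespace QuarticSymbol

/-! ### Rigidity of regular binary quartics -/

/-- The infinitesimal stabilizer in `gl₂` of a binary quartic with nonzero discriminant is trivial. -/
lemma eq_zero_of_quarticDiscr_ne_zero {a : Fin 5 → ℝ} (ha : quarticDiscr a ≠ 0) {α β γ δ : ℝ}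
    (h0 : α * a 0 + β * a 1 = 0)
    (h1 : 3 * α * a 1 + γ * a 0 + 3 * β * a 2 + δ * a 1 = 0)
    (h2 : 3 * α * a 2 + 3 * γ * a 1 + 3 * β * a 3 + 3 * δ * a 2 = 0)
    (h3 : α * a 3 + 3 * γ * a 2 + β * a 4 + 3 * δ * a 3 = 0)
    (h4 : γ * a 3 + δ * a 4 = 0) : α = 0 ∧ β = 0 ∧ γ = 0 ∧ δ = 0 := by
  -- The hypotheses are five linear equations in four unknowns. Each certificate below writes
  -- discriminant times unknown as a combination of them, with coefficients of degree five in `a`.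
  refine ⟨?_, ?_, ?_, ?_⟩ <;> refine (mul_eq_zero.1 ?_).resolve_left ha <;> unfold quarticDiscr
  · linear_combination 256 * (
      (a 0 ^ 2 * a 4 ^ 3 - 11 * a 0 * a 1 * a 3 * a 4 ^ 2 - 18 * a 0 * a 2 ^ 2 * a 4 ^ 2 + 54 *
      a 0 * a 2 * a 3 ^ 2 * a 4 - 27 * a 0 * a 3 ^ 4 + 36 * a 1 ^ 2 * a 2 * a 4 ^ 2 + a 1 ^ 2 *
      a 3 ^ 2 * a 4 - 153 * a 1 * a 2 ^ 2 * a 3 * a 4 + 90 * a 1 * a 2 * a 3 ^ 3 + 81 * a 2 ^ 4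
      * a 4 - 54 * a 2 ^ 3 * a 3 ^ 2) * h0 + (3 * a 0 * a 1 * a 2 * a 4 ^ 2 - 3 * a 0 * a 1 * a
      3 ^ 2 * a 4 - 9 * a 1 ^ 3 * a 4 ^ 2 + 42 * a 1 ^ 2 * a 2 * a 3 * a 4 - 24 * a 1 ^ 2 * a 3
      ^ 3 - 27 * a 1 * a 2 ^ 3 * a 4 + 18 * a 1 * a 2 ^ 2 * a 3 ^ 2) * h1 + (3 * a 0 * a 1 ^ 2 *
      a 4 ^ 2 - 12 * a 0 * a 1 * a 2 * a 3 * a 4 + 9 * a 0 * a 1 * a 3 ^ 3 - 3 * a 1 ^ 3 * a 3 *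
      a 4 + 9 * a 1 ^ 2 * a 2 ^ 2 * a 4 - 6 * a 1 ^ 2 * a 2 * a 3 ^ 2) * h2 + (-a 0 ^ 2 * a 1 *
      a 4 ^ 2 + 2 * a 0 * a 1 ^ 2 * a 3 * a 4 + 9 * a 0 * a 1 * a 2 ^ 2 * a 4 - 9 * a 0 * a 1 *
      a 2 * a 3 ^ 2 - 9 * a 1 ^ 3 * a 2 * a 4 + 8 * a 1 ^ 3 * a 3 ^ 2) * h3 + (3 * a 0 ^ 2 * a 1
      * a 3 * a 4 - 12 * a 0 * a 1 ^ 2 * a 2 * a 4 - 3 * a 0 * a 1 ^ 2 * a 3 ^ 2 + 9 * a 0 * a 1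
      * a 2 ^ 2 * a 3 + 9 * a 1 ^ 4 * a 4 - 6 * a 1 ^ 3 * a 2 * a 3) * h4)
  · linear_combination 256 * (
      (-a 0 ^ 2 * a 3 * a 4 ^ 2 + 18 * a 0 * a 1 * a 2 * a 4 ^ 2 - 7 * a 0 * a 1 * a 3 ^ 2 * a 4
      - 27 * a 0 * a 2 ^ 2 * a 3 * a 4 + 18 * a 0 * a 2 * a 3 ^ 3 - 27 * a 1 ^ 3 * a 4 ^ 2 + 108
      * a 1 ^ 2 * a 2 * a 3 * a 4 - 64 * a 1 ^ 2 * a 3 ^ 3 - 54 * a 1 * a 2 ^ 3 * a 4 + 36 * a 1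
      * a 2 ^ 2 * a 3 ^ 2) * h0 + (-3 * a 0 ^ 2 * a 2 * a 4 ^ 2 + 3 * a 0 ^ 2 * a 3 ^ 2 * a 4 +
      9 * a 0 * a 1 ^ 2 * a 4 ^ 2 - 42 * a 0 * a 1 * a 2 * a 3 * a 4 + 24 * a 0 * a 1 * a 3 ^ 3
      + 27 * a 0 * a 2 ^ 3 * a 4 - 18 * a 0 * a 2 ^ 2 * a 3 ^ 2) * h1 + (-3 * a 0 ^ 2 * a 1 * a
      4 ^ 2 + 12 * a 0 ^ 2 * a 2 * a 3 * a 4 - 9 * a 0 ^ 2 * a 3 ^ 3 + 3 * a 0 * a 1 ^ 2 * a 3 *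
      a 4 - 9 * a 0 * a 1 * a 2 ^ 2 * a 4 + 6 * a 0 * a 1 * a 2 * a 3 ^ 2) * h2 + (a 0 ^ 3 * a 4
      ^ 2 - 2 * a 0 ^ 2 * a 1 * a 3 * a 4 - 9 * a 0 ^ 2 * a 2 ^ 2 * a 4 + 9 * a 0 ^ 2 * a 2 * a
      3 ^ 2 + 9 * a 0 * a 1 ^ 2 * a 2 * a 4 - 8 * a 0 * a 1 ^ 2 * a 3 ^ 2) * h3 + (-3 * a 0 ^ 3
      * a 3 * a 4 + 12 * a 0 ^ 2 * a 1 * a 2 * a 4 + 3 * a 0 ^ 2 * a 1 * a 3 ^ 2 - 9 * a 0 ^ 2 *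
      a 2 ^ 2 * a 3 - 9 * a 0 * a 1 ^ 3 * a 4 + 6 * a 0 * a 1 ^ 2 * a 2 * a 3) * h4)
  · linear_combination 256 * (
      (-3 * a 0 * a 1 * a 4 ^ 3 + 3 * a 0 * a 2 * a 3 * a 4 ^ 2 + 30 * a 1 ^ 2 * a 3 * a 4 ^ 2 -
      9 * a 1 * a 2 ^ 2 * a 4 ^ 2 - 120 * a 1 * a 2 * a 3 ^ 2 * a 4 + 72 * a 1 * a 3 ^ 4 + 81 *
      a 2 ^ 3 * a 3 * a 4 - 54 * a 2 ^ 2 * a 3 ^ 3) * h0 + (a 0 ^ 2 * a 4 ^ 3 - 11 * a 0 * a 1 *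
      a 3 * a 4 ^ 2 - 9 * a 0 * a 2 ^ 2 * a 4 ^ 2 + 45 * a 0 * a 2 * a 3 ^ 2 * a 4 - 27 * a 0 *
      a 3 ^ 4 + 9 * a 1 ^ 2 * a 2 * a 4 ^ 2 + a 1 ^ 2 * a 3 ^ 2 * a 4 - 27 * a 1 * a 2 ^ 2 * a 3
      * a 4 + 18 * a 1 * a 2 * a 3 ^ 3) * h1 + (12 * a 0 * a 1 * a 2 * a 4 ^ 2 - 3 * a 0 * a 1 *
      a 3 ^ 2 * a 4 - 36 * a 0 * a 2 ^ 2 * a 3 * a 4 + 27 * a 0 * a 2 * a 3 ^ 3 - 9 * a 1 ^ 3 *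
      a 4 ^ 2 + 33 * a 1 ^ 2 * a 2 * a 3 * a 4 - 24 * a 1 ^ 2 * a 3 ^ 3) * h2 + (-3 * a 0 ^ 2 *
      a 2 * a 4 ^ 2 + 3 * a 0 * a 1 ^ 2 * a 4 ^ 2 - 6 * a 0 * a 1 * a 2 * a 3 * a 4 + 9 * a 0 *
      a 1 * a 3 ^ 3 + 27 * a 0 * a 2 ^ 3 * a 4 - 27 * a 0 * a 2 ^ 2 * a 3 ^ 2 - 3 * a 1 ^ 3 * a
      3 * a 4 - 18 * a 1 ^ 2 * a 2 ^ 2 * a 4 + 18 * a 1 ^ 2 * a 2 * a 3 ^ 2) * h3 + (-a 0 ^ 2 *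
      a 1 * a 4 ^ 2 + 9 * a 0 ^ 2 * a 2 * a 3 * a 4 + 2 * a 0 * a 1 ^ 2 * a 3 * a 4 - 27 * a 0 *
      a 1 * a 2 ^ 2 * a 4 - 18 * a 0 * a 1 * a 2 * a 3 ^ 2 + 27 * a 0 * a 2 ^ 3 * a 3 + 18 * a 1
      ^ 3 * a 2 * a 4 + 8 * a 1 ^ 3 * a 3 ^ 2 - 18 * a 1 ^ 2 * a 2 ^ 2 * a 3) * h4)
  · linear_combination 256 * (
      (3 * a 0 * a 1 * a 3 * a 4 ^ 2 + 9 * a 0 * a 2 ^ 2 * a 4 ^ 2 - 21 * a 0 * a 2 * a 3 ^ 2 *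
      a 4 + 9 * a 0 * a 3 ^ 4 - 27 * a 1 ^ 2 * a 2 * a 4 ^ 2 - 3 * a 1 ^ 2 * a 3 ^ 2 * a 4 + 135
      * a 1 * a 2 ^ 2 * a 3 * a 4 - 78 * a 1 * a 2 * a 3 ^ 3 - 81 * a 2 ^ 4 * a 4 + 54 * a 2 ^ 3
      * a 3 ^ 2) * h0 + (-a 0 ^ 2 * a 3 * a 4 ^ 2 + 9 * a 0 * a 1 * a 2 * a 4 ^ 2 + 2 * a 0 * a
      1 * a 3 ^ 2 * a 4 - 27 * a 0 * a 2 ^ 2 * a 3 * a 4 + 18 * a 0 * a 2 * a 3 ^ 3 - 18 * a 1 ^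
      2 * a 2 * a 3 * a 4 + 8 * a 1 ^ 2 * a 3 ^ 3 + 27 * a 1 * a 2 ^ 3 * a 4 - 18 * a 1 * a 2 ^
      2 * a 3 ^ 2) * h1 + (-3 * a 0 ^ 2 * a 2 * a 4 ^ 2 + 3 * a 0 ^ 2 * a 3 ^ 2 * a 4 - 6 * a 0
      * a 1 * a 2 * a 3 * a 4 - 3 * a 0 * a 1 * a 3 ^ 3 + 27 * a 0 * a 2 ^ 3 * a 4 - 18 * a 0 *
      a 2 ^ 2 * a 3 ^ 2 + 9 * a 1 ^ 3 * a 3 * a 4 - 27 * a 1 ^ 2 * a 2 ^ 2 * a 4 + 18 * a 1 ^ 2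
      * a 2 * a 3 ^ 2) * h2 + (12 * a 0 ^ 2 * a 2 * a 3 * a 4 - 9 * a 0 ^ 2 * a 3 ^ 3 - 3 * a 0
      * a 1 ^ 2 * a 3 * a 4 - 36 * a 0 * a 1 * a 2 ^ 2 * a 4 + 33 * a 0 * a 1 * a 2 * a 3 ^ 2 +
      27 * a 1 ^ 3 * a 2 * a 4 - 24 * a 1 ^ 3 * a 3 ^ 2) * h3 + (a 0 ^ 3 * a 4 ^ 2 - 11 * a 0 ^
      2 * a 1 * a 3 * a 4 - 9 * a 0 ^ 2 * a 2 ^ 2 * a 4 + 9 * a 0 ^ 2 * a 2 * a 3 ^ 2 + 45 * a 0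
      * a 1 ^ 2 * a 2 * a 4 + a 0 * a 1 ^ 2 * a 3 ^ 2 - 27 * a 0 * a 1 * a 2 ^ 2 * a 3 - 27 * a
      1 ^ 4 * a 4 + 18 * a 1 ^ 3 * a 2 * a 3) * h4)

/-! ### Covectors on the plane and coefficients of symmetric 4-vectors -/

/-- The covectors on the plane. -/
abbrev PlaneDual : Type := Plane →L[ℝ] ℝ

/-- The standard basis of the plane. -/
def stdVec (i : Fin 2) : Plane := EuclideanSpace.single i 1

/-- The standard basis of the dual of the plane. -/
def stdCovec (i : Fin 2) : PlaneDual := EuclideanSpace.proj i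

@[simp]
lemma stdCovec_apply (i : Fin 2) (v : Plane) : stdCovec i v = v i := rfl

lemma stdVec_apply (i j : Fin 2) : stdVec i j = if j = i then 1 else 0 := by
  simp [stdVec]

lemma eq_sum_stdVec (v : Plane) : v = v 0 • stdVec 0 + v 1 • stdVec 1 := by
  ext i; fin_cases i <;> simp [stdVec_apply]

/-- The area form evaluated on two covectors. -/
def wedge (ξ η : PlaneDual) : ℝ := ξ (stdVec 0) * η (stdVec 1) - ξ (stdVec 1) * η (stdVec 0)

lemma planeDual_ext {ξ η : PlaneDual} (h0 : ξ (stdVec 0) = η (stdVec 0))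
    (h1 : ξ (stdVec 1) = η (stdVec 1)) : ξ = η := by
  ext v
  rw [eq_sum_stdVec v]
  simp [h0, h1]

lemma planeDual_apply (ξ : PlaneDual) (v : Plane) :
    ξ v = v 0 * ξ (stdVec 0) + v 1 * ξ (stdVec 1) := by
  conv_lhs => rw [eq_sum_stdVec v]
  simp

lemma exists_combination {θ : Fin 2 → PlaneDual} (hθ : wedge (θ 0) (θ 1) ≠ 0) (ξ : PlaneDual) :
    ∃ c : Fin 2 → ℝ, ξ = ∑ l, c l • θ l := by
  refine ⟨![wedge ξ (θ 1) / wedge (θ 0) (θ 1), wedge (θ 0) ξ / wedge (θ 0) (θ 1)], ?_⟩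
  apply planeDual_ext <;> simp <;> field_simp <;> simp only [wedge] <;> ring

lemma linearIndependent_of_wedge_ne_zero {ξ η : PlaneDual} (h : wedge ξ η ≠ 0) :
    LinearIndependent ℝ ![ξ, η] := by
  rw [LinearIndependent.pair_iff]
  intro s t hst
  have e0 : s * ξ (stdVec 0) + t * η (stdVec 0) = 0 := by
    simpa using congr($hst (stdVec 0))
  have e1 : s * ξ (stdVec 1) + t * η (stdVec 1) = 0 := by
    simpa using congr($hst (stdVec 1))
  constructor <;> refine (mul_eq_zero.1 ?_).resolve_left h <;> unfold wedge
  · linear_combination η (stdVec 1) * e0 - η (stdVec 0) * e1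
  · linear_combination ξ (stdVec 0) * e1 - ξ (stdVec 1) * e0

namespace FourVector

section General

variable {V W : Type*} [AddCommGroup V] [Module ℝ V] [TopologicalSpace V]
  [IsTopologicalAddGroup V] [ContinuousSMul ℝ V] [AddCommGroup W] [Module ℝ W] [TopologicalSpace W]
  [IsTopologicalAddGroup W] [ContinuousSMul ℝ W]

/-- The positions of the second covector in the arguments defining the `k`-th coefficient. -/
def slot (k : Fin 5) (i : Fin 4) : Fin 2 := if 4 ≤ k.val + i.val then 1 else 0

/-- The number of positions at which `s` takes the value `1`. -/
def ones (s : Fin 4 → Fin 2) : Fin 5 :=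
  ⟨(Finset.univ.filter fun i ↦ s i = 1).card,
    Nat.lt_succ_of_le ((Finset.card_filter_le _ _).trans (by simp))⟩

/-- `slot k` is the sorted pattern whose last `k` entries are `1`. Sorting the arguments reduces
every value of a symmetric form on a coframe to one of its five coefficients. -/
lemma exists_perm_slot : ∀ s : Fin 4 → Fin 2, ∃ ρ : Equiv.Perm (Fin 4), s = slot (ones s) ∘ ρ := by
  decide

lemma coeffs_eq_slot (S : FourVector V) (θ : Fin 2 → (V →L[ℝ] ℝ)) (k : Fin 5) :
    S.coeffs (θ 0) (θ 1) k = S.form (fun i ↦ θ (slot k i)) := by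
  fin_cases k <;> refine congrArg S.form (funext fun i ↦ ?_) <;> fin_cases i <;> rfl

lemma form_comp_eq_coeffs (S : FourVector V) (θ : Fin 2 → (V →L[ℝ] ℝ)) (s : Fin 4 → Fin 2) :
    S.form (fun i ↦ θ (s i)) = S.coeffs (θ 0) (θ 1) (ones s) := by
  obtain ⟨ρ, hρ⟩ := exists_perm_slot s
  rw [coeffs_eq_slot, ← S.symm ρ fun i ↦ θ (slot (ones s) i)]
  exact congrArg S.form (funext fun i ↦ congrArg θ (congrFun hρ i))

lemma form_sum_smul (S : FourVector V) (θ : Fin 2 → (V →L[ℝ] ℝ)) (c : Fin 4 → Fin 2 → ℝ) :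
    S.form (fun i ↦ ∑ l, c i l • θ l)
      = ∑ s : Fin 4 → Fin 2, (∏ i, c i (s i)) * S.coeffs (θ 0) (θ 1) (ones s) := by
  rw [MultilinearMap.map_sum]
  refine Finset.sum_congr rfl fun s _ ↦ ?_
  rw [MultilinearMap.map_smul_univ, form_comp_eq_coeffs, smul_eq_mul]

/-- The derivative of `θ ↦ S.coeffs (θ 0) (θ 1)` at `θ` in the direction `θ'`. -/
def coeffsDeriv (S : FourVector V) (θ θ' : Fin 2 → (V →L[ℝ] ℝ)) (k : Fin 5) : ℝ :=
  ∑ i, S.form (update (fun j ↦ θ (slot k j)) i (θ' (slot k i)))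

lemma form_update_combination (S : FourVector V) (θ : Fin 2 → (V →L[ℝ] ℝ)) (s : Fin 4 → Fin 2)
    (i : Fin 4) (c : Fin 2 → ℝ) :
    S.form (update (fun j ↦ θ (s j)) i (∑ l, c l • θ l))
      = ∑ l, c l * S.coeffs (θ 0) (θ 1) (ones (update s i l)) := by
  rw [MultilinearMap.map_update_sum]
  refine Finset.sum_congr rfl fun l _ ↦ ?_
  rw [MultilinearMap.map_update_smul, smul_eq_mul, ← form_comp_eq_coeffs]
  congr 2
  ext j : 1
  by_cases h : j = i
  · subst h; simp
  · simp [h]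

/-- The image of a symmetric 4-vector under a linear map. -/
def map (L : V →L[ℝ] W) (S : FourVector V) : FourVector W where
  form := S.form.compLinearMap fun _ ↦
    { toFun := fun ξ ↦ ξ.comp L, map_add' := by simp, map_smul' := by simp }
  symm ρ α := S.symm ρ fun i ↦ (α i).comp L

lemma map_form (L : V →L[ℝ] W) (S : FourVector V) (α : Fin 4 → (W →L[ℝ] ℝ)) :
    (S.map L).form α = S.form fun i ↦ (α i).comp L := rfl

lemma map_coeffs (L : V →L[ℝ] W) (S : FourVector V) (ξ η : W →L[ℝ] ℝ) :
    (S.map L).coeffs ξ η = S.coeffs (ξ.comp L) (η.comp L) := by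
  ext k
  refine ((S.map L).coeffs_eq_slot ![ξ, η] k).trans
    (Eq.trans ?_ (S.coeffs_eq_slot ![ξ.comp L, η.comp L] k).symm)
  rw [map_form]
  congr 1
  ext i : 1
  generalize slot k i = j
  fin_cases j <;> rfl

lemma IsRegular.map {S : FourVector V} (hS : S.IsRegular) (e : V ≃L[ℝ] W) :
    (S.map (e : V →L[ℝ] W)).IsRegular := by
  intro ξ η h
  rw [map_coeffs]
  refine hS _ _ ?_
  rw [LinearIndependent.pair_iff] at h ⊢
  intro s t hst
  refine h s t ?_
  ext w
  simpa using congr($hst (e.symm w))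

lemma ofCoeffs_coeffs (a : Fin 5 → ℝ) {v w : V} {ξ η : V →L[ℝ] ℝ} (h1 : ξ v = 1) (h2 : ξ w = 0)
    (h3 : η v = 0) (h4 : η w = 1) : (ofCoeffs a v w).coeffs ξ η = a := by
  have hd (j l : Fin 2) : (![ξ, η] j) (![v, w] l) = if j = l then 1 else 0 := by
    fin_cases j <;> fin_cases l <;> simp [h1, h2, h3, h4]
  -- The permutations preserving the pattern `slot k` number `k! (4 - k)!`. With the factor `1 / 24`
  -- of `symProd` this is the inverse of the binomial weight `1, 4, 6, 4, 1` in `ofCoeffs`.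
  have hcard : ∀ k m : Fin 5,
      (Finset.univ.filter fun ρ : Equiv.Perm (Fin 4) ↦ ∀ i, slot k i = slot m (ρ i)).card
        = if k = m then ![24, 6, 4, 6, 24] k else 0 := by decide
  have hs (k m : Fin 5) : symProd (fun j ↦ ![v, w] (slot m j)) (fun i ↦ ![ξ, η] (slot k i))
      = ((if k = m then ![24, 6, 4, 6, 24] k else 0 : ℕ) : ℝ) / 24 := by
    simp only [symProd_apply, hd, Finset.prod_boole, Finset.mem_univ, true_implies]
    rw [← hcard k m, Finset.sum_boole, one_div, inv_mul_eq_div]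
  have e (m : Fin 5) : (fun j ↦ ![v, w] (slot m j))
      = ![![v, v, v, v], ![v, v, v, w], ![v, v, w, w], ![v, w, w, w], ![w, w, w, w]] m := by
    ext j : 1
    fin_cases m <;> fin_cases j <;> rfl
  simp only [e] at hs
  ext k
  refine ((ofCoeffs a v w).coeffs_eq_slot ![ξ, η] k).trans ?_
  have h (m : Fin 5) := hs k m
  have g0 := h 0
  have g1 := h 1
  have g2 := h 2
  have g3 := h 3
  have g4 := h 4
  simp only [Matrix.cons_val] at g0 g1 g2 g3 g4
  simp only [ofCoeffs, add_apply, smul_apply, g0, g1, g2, g3, g4]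
  fin_cases k <;> simp <;> ring_nf

end General

/-- Expanding `θ'` in the basis `θ` gives a 2 × 2 matrix, and `coeffsDeriv` becomes its
infinitesimal action on the quartic, which has trivial kernel by regularity. -/
lemma eq_zero_of_coeffsDeriv_eq_zero {S : FourVector Plane} (hS : S.IsRegular)
    {θ θ' : Fin 2 → PlaneDual} (hθ : wedge (θ 0) (θ 1) ≠ 0) (h : S.coeffsDeriv θ θ' = 0) :
    θ' = 0 := by
  choose c hc using fun j ↦ exists_combination hθ (θ' j)
  have key (k : Fin 5) : ∑ i, ∑ l, c (slot k i) l * S.coeffs (θ 0) (θ 1)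
      (ones (update (slot k) i l)) = 0 := by
    refine Eq.trans (Finset.sum_congr rfl fun i _ ↦ ?_) (congrFun h k)
    rw [hc, form_update_combination]
  -- The cyclic arithmetic of `Fin 5` never wraps: a slot with value `0` forces `k ≤ 3`, and one
  -- with value `1` forces `k ≥ 1`.
  have o (k : Fin 5) (i : Fin 4) (l : Fin 2) : ones (update (slot k) i l)
      = if l = 0 then (if slot k i = 0 then k else k - 1) else
        (if slot k i = 0 then k + 1 else k) := by
    revert k i l; decide
  have hreg := hS _ _ (linearIndependent_of_wedge_ne_zero hθ)
  simp only [o] at key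
  have k0 := key 0
  have k1 := key 1
  have k2 := key 2
  have k3 := key 3
  have k4 := key 4
  simp [Fin.sum_univ_four, Fin.sum_univ_two, slot] at k0 k1 k2 k3 k4
  -- Equal slots contribute equal terms, which yields multiplicity 4 for the two extreme
  -- coefficients and 2 for the middle one; the factors below adjust for this.
  obtain ⟨h00, h01, h10, h11⟩ := eq_zero_of_quarticDiscr_ne_zero hreg
    (α := c 0 0) (β := c 0 1) (γ := c 1 0) (δ := c 1 1) (by linear_combination k0 / 4)
    (by linear_combination k1) (by linear_combination 3 / 2 * k2) (by linear_combination k3)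
    (by linear_combination k4 / 4)
  ext j : 1
  rw [hc]
  fin_cases j <;> simp [h00, h01, h10, h11]

lemma form_eq_of_coeffs_eq {S S' : FourVector Plane} {θ : Fin 2 → PlaneDual}
    (hθ : wedge (θ 0) (θ 1) ≠ 0) (h : S.coeffs (θ 0) (θ 1) = S'.coeffs (θ 0) (θ 1)) :
    S.form = S'.form := by
  ext α
  choose c hc using fun i ↦ exists_combination hθ (α i)
  obtain rfl : α = fun i ↦ ∑ l, c i l • θ l := funext hc
  rw [form_sum_smul, form_sum_smul, h]

end FourVector

/-! ### Implicit function theorem -/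

section Implicit

variable {E₁ E₂ F : Type*} [NormedAddCommGroup E₁] [NormedSpace ℝ E₁] [CompleteSpace E₁]
  [NormedAddCommGroup E₂] [NormedSpace ℝ E₂] [CompleteSpace E₂]
  [NormedAddCommGroup F] [NormedSpace ℝ F] [CompleteSpace F]

/-- The implicit function theorem, with smoothness of the implicit function near the base point. -/
lemma exists_smooth_implicitFunction {f : E₁ × E₂ → F} {u : E₁ × E₂} {O : Set (E₁ × E₂)}
    (hO : IsOpen O) (hu : u ∈ O) (hf : ContDiffOn ℝ ∞ f O)
    (hinv : (fderiv ℝ f u ∘L .inr ℝ E₁ E₂).IsInvertible) :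
    ∃ ψ : E₁ → E₂, ψ u.1 = u.2 ∧ ∀ᶠ x in 𝓝 u.1, ContDiffAt ℝ ∞ ψ x ∧ f (x, ψ x) = f u ∧
      (x, ψ x) ∈ O ∧ (fderiv ℝ f (x, ψ x) ∘L .inr ℝ E₁ E₂).IsInvertible := by
  have hn : (∞ : ℕ∞ω) ≠ 0 := by simp
  have cdf (v) (hv : v ∈ O) : ContDiffAt ℝ ∞ f v := hf.contDiffAt (hO.mem_nhds hv)
  let ψ := (cdf u hu).implicitFunction hn hinv
  have hψu : ψ u.1 = u.2 := (cdf u hu).implicitFunction_apply_self hn hinv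
  have hψc : Tendsto (fun x ↦ (x, ψ x)) (𝓝 u.1) (𝓝 u) := by
    have h := ((cdf u hu).contDiffAt_implicitFunction hn hinv).continuousAt
    have h' : ContinuousAt (fun x ↦ (x, ψ x)) u.1 := continuousAt_id.prodMk h
    rw [ContinuousAt] at h'
    rwa [hψu] at h'
  have hder : ContinuousAt (fun v ↦ fderiv ℝ f v ∘L .inr ℝ E₁ E₂) u :=
    (((cdf u hu).fderiv_right (m := ∞) (by simp)).continuousAt).clm_comp continuousAt_const
  have hopen : ∀ᶠ v in 𝓝 u, (fderiv ℝ f v ∘L .inr ℝ E₁ E₂).IsInvertible := by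
    obtain ⟨e, he⟩ := hinv
    have := ContinuousLinearEquiv.nhds e
    rw [he] at this
    exact hder.eventually this
  have hiff := (cdf u hu).eventually_apply_eq_iff_implicitFunction hn hinv
  have hval := (cdf u hu).eventually_apply_implicitFunction hn hinv
  refine ⟨ψ, hψu, ?_⟩
  filter_upwards [hψc.eventually (hO.mem_nhds hu), hψc.eventually hopen,
    hψc.eventually hiff.eventually_nhds, hval] with x hxO hxi hxiff hxval
  refine ⟨?_, hxval, hxO, hxi⟩
  -- The theorem is applied afresh at `(x, ψ x)`. The function it yields is smooth at `x`, and local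
  -- uniqueness of solutions identifies it with `ψ` near `x`.
  have hψ' := (cdf _ hxO).contDiffAt_implicitFunction hn hxi
  have hval' := (cdf _ hxO).eventually_apply_implicitFunction hn hxi
  have hself := (cdf _ hxO).implicitFunction_apply_self hn hxi
  have hc : Tendsto (fun y ↦ (y, (cdf _ hxO).implicitFunction hn hxi y)) (𝓝 x) (𝓝 (x, ψ x)) := by
    have h' : ContinuousAt (fun y ↦ (y, (cdf _ hxO).implicitFunction hn hxi y)) x :=
      continuousAt_id.prodMk hψ'.continuousAt
    rw [ContinuousAt] at h'
    rwa [hself] at h'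
  refine hψ'.congr_of_eventuallyEq ?_
  filter_upwards [hval', hc.eventually hxiff] with y hy hy'
  exact hy'.1 (hy.trans hxval)

end Implicit

/-! ### Calculus of 1-forms on the plane -/

/-- The coefficient `(∂₀ν₁ - ∂₁ν₀)` of the exterior derivative of a 1-form on the plane. -/
def curl (ν : Plane → PlaneDual) (z : Plane) : ℝ :=
  fderiv ℝ ν z (stdVec 0) (stdVec 1) - fderiv ℝ ν z (stdVec 1) (stdVec 0)

lemma fderiv_symm_of_curl_eq_zero {ν : Plane → PlaneDual} {z : Plane} (h : curl ν z = 0)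
    (v w : Plane) : fderiv ℝ ν z v w = fderiv ℝ ν z w v := by
  rw [eq_sum_stdVec v, eq_sum_stdVec w]
  simp only [map_add, map_smul, add_apply, smul_apply, smul_eq_mul]
  unfold curl at h
  linear_combination (v 0 * w 1 - v 1 * w 0) * h

lemma fderiv_sub_eq_curl {ν : Plane → PlaneDual} {z : Plane} (v w : Plane) :
    fderiv ℝ ν z v w - fderiv ℝ ν z w v = (v 0 * w 1 - v 1 * w 0) * curl ν z := by
  rw [eq_sum_stdVec v, eq_sum_stdVec w]
  simp only [map_add, map_smul, add_apply, smul_apply, smul_eq_mul]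
  simp [stdVec_apply, curl]
  ring

lemma two_le_infty : (2 : ℕ∞ω) ≤ ∞ := WithTop.coe_le_coe.2 (le_top : (2 : ℕ∞) ≤ ⊤)

lemma curl_fderiv {f : Plane → ℝ} {z : Plane} (hf : ContDiffAt ℝ ∞ f z) :
    curl (fderiv ℝ f) z = 0 := by
  have h := hf.isSymmSndFDerivAt (by simpa using two_le_infty)
  exact sub_eq_zero.2 (h.eq _ _)

lemma curl_smul {h : Plane → ℝ} {ν : Plane → PlaneDual} {z : Plane}
    (hh : DifferentiableAt ℝ h z) (hν : DifferentiableAt ℝ ν z) :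
    curl (fun z ↦ h z • ν z) z = h z * curl ν z + wedge (fderiv ℝ h z) (ν z) := by
  unfold curl
  rw [fderiv_fun_smul hh hν]
  simp [wedge]
  ring

lemma curl_add {ν ν' : Plane → PlaneDual} {z : Plane}
    (hν : DifferentiableAt ℝ ν z) (hν' : DifferentiableAt ℝ ν' z) :
    curl (fun z ↦ ν z + ν' z) z = curl ν z + curl ν' z := by
  unfold curl
  rw [fderiv_fun_add hν hν']
  simp
  ring

/-- The Poincaré lemma for smooth 1-forms on a convex open subset of the plane. -/
lemma exists_potential {ν : Plane → PlaneDual} {s : Set Plane} (hs : Convex ℝ s) (hso : IsOpen s)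
    (hν : ContDiffOn ℝ ∞ ν s) (h : ∀ z ∈ s, curl ν z = 0) :
    ∃ f : Plane → ℝ, ContDiffOn ℝ ∞ f s ∧ ∀ z ∈ s, fderiv ℝ f z = ν z := by
  obtain ⟨f, hf⟩ := hs.exists_forall_hasFDerivAt_of_fderiv_symmetric hso
    (hν.differentiableOn (by simp)) fun z hz ↦ fderiv_symm_of_curl_eq_zero (h z hz)
  refine ⟨f, ?_, fun z hz ↦ (hf z hz).fderiv⟩
  rw [contDiffOn_infty_iff_fderiv_of_isOpen hso]
  exact ⟨fun z hz ↦ (hf z hz).differentiableAt.differentiableWithinAt,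
    hν.congr fun z hz ↦ (hf z hz).fderiv⟩

/-! ### Coframes fixing four combinations of the coefficients -/

lemma planeDual_eq_sum (ξ : PlaneDual) : ξ = ∑ l, ξ (stdVec l) • stdCovec l := by
  apply planeDual_ext <;> simp [stdVec_apply]

namespace FourVector

lemma coeffs_eq_sum (S : FourVector Plane) (θ : Fin 2 → PlaneDual) (k : Fin 5) :
    S.coeffs (θ 0) (θ 1) k = ∑ s : Fin 4 → Fin 2, (∏ i, θ (slot k i) (stdVec (s i))) *
      S.coeffs (stdCovec 0) (stdCovec 1) (ones s) := by
  rw [coeffs_eq_slot, ← form_sum_smul S stdCovec fun i l ↦ θ (slot k i) (stdVec l)]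
  exact congrArg S.form (funext fun i ↦ planeDual_eq_sum _)

/-- The 4-linear form of a symmetric 4-vector on the plane, as a continuous multilinear map. -/
def contForm (S : FourVector Plane) : ContinuousMultilinearMap ℝ (fun _ : Fin 4 ↦ PlaneDual) ℝ where
  toMultilinearMap := S.form
  cont := by
    have h (α : Fin 4 → PlaneDual) : S.form α
        = ∑ s : Fin 4 → Fin 2, (∏ i, α i (stdVec (s i))) *
          S.coeffs (stdCovec 0) (stdCovec 1) (ones s) := by
      rw [← form_sum_smul S stdCovec fun i l ↦ α i (stdVec l)]
      exact congrArg S.form (funext fun i ↦ planeDual_eq_sum _)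
    change Continuous fun α ↦ S.form α
    simp only [h]
    fun_prop

/-- `coeffsDeriv` as a continuous linear map. -/
def coeffsDerivL (S : FourVector Plane) (θ : Fin 2 → PlaneDual) :
    (Fin 2 → PlaneDual) →L[ℝ] (Fin 5 → ℝ) :=
  ContinuousLinearMap.pi fun k ↦ (S.contForm.linearDeriv fun i ↦ θ (slot k i)).comp
    (ContinuousLinearMap.pi fun i ↦ ContinuousLinearMap.proj (slot k i))

lemma coeffsDerivL_apply (S : FourVector Plane) (θ θ' : Fin 2 → PlaneDual) :
    S.coeffsDerivL θ θ' = S.coeffsDeriv θ θ' := by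
  ext k
  simp [coeffsDerivL, coeffsDeriv]
  rfl

lemma hasFDerivAt_coeffs (S : FourVector Plane) (θ : Fin 2 → PlaneDual) :
    HasFDerivAt (fun θ : Fin 2 → PlaneDual ↦ S.coeffs (θ 0) (θ 1)) (S.coeffsDerivL θ) θ := by
  rw [hasFDerivAt_pi']
  intro k
  have h := (S.contForm.hasFDerivAt fun i ↦ θ (slot k i)).comp θ
    (ContinuousLinearMap.pi (R := ℝ) (φ := fun _ : Fin 4 ↦ PlaneDual)
      fun i ↦ ContinuousLinearMap.proj (R := ℝ) (φ := fun _ : Fin 2 ↦ PlaneDual)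
        (slot k i)).hasFDerivAt
  refine (h.congr_of_eventuallyEq (.of_forall fun θ ↦ ?_))
  exact S.coeffs_eq_slot θ k

lemma contDiffOn_coeffs {S : Plane → FourVector Plane} {s : Set Plane}
    (hS : ContDiffOn ℝ ∞ (fun z ↦ (S z).coeffs (stdCovec 0) (stdCovec 1)) s) :
    ContDiffOn ℝ ∞ (fun u : Plane × (Fin 2 → PlaneDual) ↦ (S u.1).coeffs (u.2 0) (u.2 1))
      (s ×ˢ univ) := by
  rw [contDiffOn_pi]
  intro k
  simp only [coeffs_eq_sum _ _ k]
  refine ContDiffOn.sum fun σ _ ↦ ContDiffOn.mul ?_ ?_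
  · refine ContDiff.contDiffOn ?_
    fun_prop
  · exact ((contDiffOn_pi.1 hS) _).comp contDiff_fst.contDiffOn fun u hu ↦ hu.1

lemma wedge_stdCovec : wedge (stdCovec 0) (stdCovec 1) = 1 := by
  simp [wedge, stdVec_apply]

/-- By rigidity the derivative of the coefficients with respect to the coframe is injective, so it
has a left inverse `L`. The equation `L (coefficients) = const` can then be solved for the coframe.
The conclusion records exactly what later forces this coframe to be parallel. -/
lemma exists_implicit_coframe {S : Plane → FourVector Plane} {s : Set Plane} (hs : IsOpen s)
    {z₀ : Plane} (hz₀ : z₀ ∈ s) (hreg : (S z₀).IsRegular)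
    (hS : ContDiffOn ℝ ∞ (fun z ↦ (S z).coeffs (stdCovec 0) (stdCovec 1)) s) :
    ∃ (θ : Plane → Fin 2 → PlaneDual) (L : (Fin 5 → ℝ) →L[ℝ] (Fin 2 → PlaneDual)),
      ∀ᶠ z in 𝓝 z₀, ContDiffAt ℝ ∞ θ z ∧ wedge (θ z 0) (θ z 1) ≠ 0 ∧
        (∀ θ', L ((S z).coeffsDeriv (θ z) θ') = 0 → θ' = 0) ∧
        DifferentiableAt ℝ (fun z ↦ (S z).coeffs (θ z 0) (θ z 1)) z ∧
        fderiv ℝ (fun z ↦ L ((S z).coeffs (θ z 0) (θ z 1))) z = 0 := by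
  have hker : ((S z₀).coeffsDerivL stdCovec : (Fin 2 → PlaneDual) →ₗ[ℝ] (Fin 5 → ℝ)).ker = ⊥ := by
    refine (Submodule.eq_bot_iff _).2 fun θ' h ↦ ?_
    refine eq_zero_of_coeffsDeriv_eq_zero hreg (θ := stdCovec) (by simp [wedge_stdCovec]) ?_
    rw [← coeffsDerivL_apply]
    exact h
  obtain ⟨L₀, hL₀⟩ := LinearMap.exists_leftInverse_of_injective _ hker
  let L : (Fin 5 → ℝ) →L[ℝ] (Fin 2 → PlaneDual) := LinearMap.toContinuousLinearMap L₀
  -- At the base point the partial derivative in the coframe variable is the identity, so the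
  -- implicit function theorem applies with `stdCovec` as initial value.
  have hL : L ∘L (S z₀).coeffsDerivL stdCovec = .id ℝ _ := by
    ext1 θ'
    exact congr($hL₀ θ')
  let f : Plane × (Fin 2 → PlaneDual) → (Fin 2 → PlaneDual) :=
    fun u ↦ L ((S u.1).coeffs (u.2 0) (u.2 1))
  have hO : IsOpen (s ×ˢ (univ : Set (Fin 2 → PlaneDual))) := hs.prod isOpen_univ
  have hG := contDiffOn_coeffs hS
  have hf : ContDiffOn ℝ ∞ f (s ×ˢ univ) := L.contDiff.comp_contDiffOn hG
  have hpartial (u : Plane × (Fin 2 → PlaneDual)) (hu : u ∈ s ×ˢ (univ : Set (Fin 2 → PlaneDual))) :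
      fderiv ℝ f u ∘L .inr ℝ Plane (Fin 2 → PlaneDual) = L ∘L (S u.1).coeffsDerivL u.2 := by
    have h1 : HasFDerivAt f (fderiv ℝ f u) (u.1, u.2) :=
      ((hf.contDiffAt (hO.mem_nhds hu)).differentiableAt (by simp)).hasFDerivAt
    have h2 := h1.comp u.2 (hasFDerivAt_prodMk_right u.1 u.2)
    exact h2.unique (L.hasFDerivAt.comp u.2 ((S u.1).hasFDerivAt_coeffs u.2))
  obtain ⟨θ, hθ₀, hθ⟩ := exists_smooth_implicitFunction (u := (z₀, stdCovec)) hO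
    ⟨hz₀, mem_univ _⟩ hf (by
      rw [hpartial _ ⟨hz₀, mem_univ _⟩, hL]
      exact ⟨.refl ℝ _, rfl⟩)
  refine ⟨θ, L, ?_⟩
  have hwedge : ∀ᶠ z in 𝓝 z₀, wedge (θ z 0) (θ z 1) ≠ 0 := by
    have hc : ContinuousAt θ z₀ := hθ.self_of_nhds.1.continuousAt
    have hc' : ContinuousAt (fun z ↦ wedge (θ z 0) (θ z 1)) z₀ := by
      have h (i l) : ContinuousAt (fun z ↦ θ z i (stdVec l)) z₀ :=
        (continuousAt_pi.1 hc i).clm_apply continuousAt_const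
      exact ((h 0 0).mul (h 1 1)).sub ((h 0 1).mul (h 1 0))
    refine hc'.eventually_ne ?_
    rw [show θ z₀ = stdCovec from hθ₀, wedge_stdCovec]
    exact one_ne_zero
  filter_upwards [hθ.eventually_nhds, hwedge] with z hz hwz
  obtain ⟨h1, h2, h3, h4⟩ := hz.self_of_nhds
  refine ⟨h1, hwz, fun θ' hθ' ↦ ?_, ?_, ?_⟩
  · rw [hpartial _ h3] at h4
    have := h4.bijective.injective (a₁ := θ') (a₂ := 0)
    refine this ?_
    rw [map_zero, ← hθ', ← coeffsDerivL_apply]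
    rfl
  · exact ((hG.contDiffAt (hO.mem_nhds h3)).comp z
      (contDiffAt_id.prodMk h1)).differentiableAt (by simp)
  · have : (fun z ↦ L ((S z).coeffs (θ z 0) (θ z 1))) =ᶠ[𝓝 z] fun _ ↦ f (z₀, stdCovec) :=
      hz.mono fun y hy ↦ hy.2.1
    rw [this.fderiv_eq]
    simp

end FourVector

/-! ### Fields and symbols in chart coordinates -/

variable {M : Type*} [TopologicalSpace M] [ChartedSpace Plane M] [IsManifold (𝓡 2) ∞ M]

/-- The trivialization of the tangent bundle given by the preferred chart at `p₀`. -/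
abbrev chartTriv (p₀ : M) := trivializationAt Plane (TangentSpace (𝓡 2) : M → Type _) p₀

/-- The derivative at `q` of the preferred chart at `p₀`. -/
def chartDiff (p₀ q : M) : TangentSpace (𝓡 2) q →L[ℝ] Plane :=
  (chartTriv p₀).continuousLinearMapAt ℝ q

/-- The inverse of the derivative at `q` of the preferred chart at `p₀`. -/
def chartDiffSymm (p₀ q : M) : Plane →L[ℝ] TangentSpace (𝓡 2) q :=
  (chartTriv p₀).symmL ℝ q

/-- The pull-back of a covector field on the plane by the preferred chart at `p₀`. -/
def coordCovector (p₀ : M) (ξ : Plane → PlaneDual) (q : M) : TangentSpace (𝓡 2) q →L[ℝ] ℝ :=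
  (ξ (chartAt Plane p₀ q)).comp (chartDiff p₀ q)

/-- The pull-back of a vector field on the plane by the preferred chart at `p₀`. -/
def coordVector (p₀ : M) (X : Plane → Plane) (q : M) : TangentSpace (𝓡 2) q :=
  chartDiffSymm p₀ q (X (chartAt Plane p₀ q))

lemma mem_chartTriv_baseSet {p₀ q : M} (hq : q ∈ (chartAt Plane p₀).source) :
    q ∈ (chartTriv p₀).baseSet := by
  simpa using hq

lemma chartDiff_chartDiffSymm {p₀ q : M} (hq : q ∈ (chartAt Plane p₀).source) (v : Plane) :
    chartDiff p₀ q (chartDiffSymm p₀ q v) = v :=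
  (chartTriv p₀).continuousLinearMapAt_symmL (mem_chartTriv_baseSet hq) v

lemma chartDiffSymm_chartDiff {p₀ q : M} (hq : q ∈ (chartAt Plane p₀).source)
    (v : TangentSpace (𝓡 2) q) : chartDiffSymm p₀ q (chartDiff p₀ q v) = v :=
  (chartTriv p₀).symmL_continuousLinearMapAt (mem_chartTriv_baseSet hq) v

/-- The derivative at `q` of the preferred chart at `p₀`, as a linear equivalence. -/
def chartDiffEquiv {p₀ q : M} (hq : q ∈ (chartAt Plane p₀).source) :
    TangentSpace (𝓡 2) q ≃L[ℝ] Plane :=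
  ContinuousLinearEquiv.equivOfInverse (chartDiff p₀ q) (chartDiffSymm p₀ q)
    (chartDiffSymm_chartDiff hq) (chartDiff_chartDiffSymm hq)

lemma coordCovector_coordVector {p₀ q : M} (hq : q ∈ (chartAt Plane p₀).source)
    (ξ : Plane → PlaneDual) (X : Plane → Plane) :
    coordCovector p₀ ξ q (coordVector p₀ X q)
      = ξ (chartAt Plane p₀ q) (X (chartAt Plane p₀ q)) := by
  simp [coordCovector, coordVector, chartDiff_chartDiffSymm hq]

omit [IsManifold (𝓡 2) ∞ M] in
lemma extChartAt_eq_chartAt (p₀ : M) : ⇑(extChartAt (𝓡 2) p₀) = chartAt Plane p₀ := by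
  ext q
  simp [extChartAt]

lemma chartDiff_eq_mfderiv {p₀ q : M} (hq : q ∈ (chartAt Plane p₀).source) :
    chartDiff p₀ q = mfderiv (𝓡 2) (𝓡 2) (chartAt Plane p₀) q := by
  rw [chartDiff, TangentBundle.continuousLinearMapAt_trivializationAt hq, extChartAt_eq_chartAt]

lemma contMDiffAt_chart {p₀ q : M} (hq : q ∈ (chartAt Plane p₀).source) :
    ContMDiffAt (𝓡 2) (𝓡 2) ∞ (chartAt Plane p₀) q :=
  contMDiffAt_of_mem_maximalAtlas (IsManifold.chart_mem_maximalAtlas p₀) hq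

omit [IsManifold (𝓡 2) ∞ M] in
lemma eventually_mem_chart_source {p₀ q : M} (hq : q ∈ (chartAt Plane p₀).source) :
    ∀ᶠ q' in 𝓝 q, q' ∈ (chartAt Plane p₀).source :=
  (chartAt Plane p₀).open_source.mem_nhds hq

/-- The trivialization of the cotangent bundle given by the preferred chart at `p₀`. -/
abbrev chartDualTriv (p₀ : M) := trivializationAt PlaneDual
  (fun q : M ↦ TangentSpace (𝓡 2) q →L[ℝ] Bundle.Trivial M ℝ q) p₀

lemma mem_chartDualTriv_baseSet {p₀ q : M} (hq : q ∈ (chartAt Plane p₀).source) :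
    q ∈ (chartDualTriv p₀).baseSet := by
  rw [hom_trivializationAt_baseSet]
  exact ⟨mem_chartTriv_baseSet hq, by simp⟩

lemma chartDualTriv_apply (p₀ q : M) (α : TangentSpace (𝓡 2) q →L[ℝ] ℝ) :
    (chartDualTriv p₀ (Bundle.TotalSpace.mk' PlaneDual
      (E := fun q : M ↦ TangentSpace (𝓡 2) q →L[ℝ] Bundle.Trivial M ℝ q) q α)).2
      = α.comp (chartDiffSymm p₀ q) := by
  refine (congrArg Prod.snd (hom_trivializationAt_apply (σ := RingHom.id ℝ) (F₁ := Plane)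
    (E₁ := fun q : M ↦ TangentSpace (𝓡 2) q) (F₂ := ℝ) (E₂ := Bundle.Trivial M ℝ) p₀
    (Bundle.TotalSpace.mk' PlaneDual q α))).trans ?_
  ext v
  simp [ContinuousLinearMap.inCoordinates, chartDiffSymm]

lemma chartDualTriv_coordCovector {p₀ q : M} (hq : q ∈ (chartAt Plane p₀).source)
    (ξ : Plane → PlaneDual) :
    (fun q ↦ (chartDualTriv p₀ (Bundle.TotalSpace.mk' PlaneDual
      (E := fun q : M ↦ TangentSpace (𝓡 2) q →L[ℝ] Bundle.Trivial M ℝ q) q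
        (coordCovector p₀ ξ q))).2) =ᶠ[𝓝 q] fun q ↦ ξ (chartAt Plane p₀ q) := by
  filter_upwards [eventually_mem_chart_source hq] with q' hq'
  rw [chartDualTriv_apply]
  ext v
  simp [coordCovector, chartDiff_chartDiffSymm hq']

lemma smoothCovectorAt_coord {p₀ q : M} (hq : q ∈ (chartAt Plane p₀).source)
    {ξ : Plane → PlaneDual} (hξ : ContDiffAt ℝ ∞ ξ (chartAt Plane p₀ q)) :
    SmoothCovectorAt (coordCovector p₀ ξ) q := by
  rw [SmoothCovectorAt, Bundle.Trivialization.contMDiffAt_section_iff (IB := 𝓡 2)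
    (e := chartDualTriv p₀) (s := coordCovector p₀ ξ) (mem_chartDualTriv_baseSet hq)]
  refine ContMDiffAt.congr_of_eventuallyEq ?_ (chartDualTriv_coordCovector hq ξ)
  exact ContMDiffAt.comp q hξ.contMDiffAt (contMDiffAt_chart hq)

lemma diffCovectorAt_coord {p₀ q : M} (hq : q ∈ (chartAt Plane p₀).source)
    {ξ : Plane → PlaneDual} (hξ : DifferentiableAt ℝ ξ (chartAt Plane p₀ q)) :
    DiffCovectorAt (coordCovector p₀ ξ) q := by
  rw [DiffCovectorAt, Bundle.Trivialization.mdifferentiableAt_section_iff (IB := 𝓡 2)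
    (e := chartDualTriv p₀) (s := coordCovector p₀ ξ) (mem_chartDualTriv_baseSet hq)]
  refine MDifferentiableAt.congr_of_eventuallyEq ?_ (chartDualTriv_coordCovector hq ξ)
  exact MDifferentiableAt.comp q hξ.mdifferentiableAt
    ((contMDiffAt_chart hq).mdifferentiableAt (by simp))

lemma diffVectorAt_coord {p₀ q : M} (hq : q ∈ (chartAt Plane p₀).source)
    {X : Plane → Plane} (hX : DifferentiableAt ℝ X (chartAt Plane p₀ q)) :
    DiffVectorAt (coordVector p₀ X) q := by
  rw [DiffVectorAt, Bundle.Trivialization.mdifferentiableAt_section_iff (IB := 𝓡 2)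
    (e := chartTriv p₀) (s := coordVector p₀ X) (mem_chartTriv_baseSet hq)]
  have h : (fun q ↦ (chartTriv p₀ ⟨q, coordVector p₀ X q⟩).2)
      =ᶠ[𝓝 q] fun q ↦ X (chartAt Plane p₀ q) := by
    filter_upwards [eventually_mem_chart_source hq] with q' hq'
    have h' := chartDiff_chartDiffSymm hq' (X (chartAt Plane p₀ q'))
    rwa [chartDiff, Bundle.Trivialization.continuousLinearMapAt_apply_of_mem (R := ℝ) _
      (mem_chartTriv_baseSet hq')] at h'
  refine MDifferentiableAt.congr_of_eventuallyEq ?_ h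
  exact MDifferentiableAt.comp q hX.mdifferentiableAt
    ((contMDiffAt_chart hq).mdifferentiableAt (by simp))

lemma mvfderiv_comp_chart {F : Type*} [NormedAddCommGroup F] [NormedSpace ℝ F] {p₀ q : M}
    (hq : q ∈ (chartAt Plane p₀).source)
    {g : Plane → F} (hg : DifferentiableAt ℝ g (chartAt Plane p₀ q)) (v : TangentSpace (𝓡 2) q) :
    mvfderiv (𝓡 2) (fun q ↦ g (chartAt Plane p₀ q)) q v
      = fderiv ℝ g (chartAt Plane p₀ q) (chartDiff p₀ q v) := by
  have h := mfderiv_comp (I := 𝓡 2) (I' := 𝓡 2) (I'' := 𝓘(ℝ, F)) q hg.mdifferentiableAt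
    ((contMDiffAt_chart hq).mdifferentiableAt (by simp))
  rw [mfderiv_eq_fderiv] at h
  rw [chartDiff_eq_mfderiv hq, mvfderiv]
  exact congr($h v)

/-- The constant vector field on the plane. -/
def constField (u z : Plane) : TangentSpace (𝓡 2) z := u

lemma mdifferentiableAt_constField (u z : Plane) : MDifferentiableAt (𝓡 2) ((𝓡 2).prod (𝓡 2))
    (fun z ↦ Bundle.TotalSpace.mk' Plane (E := fun z : Plane ↦ TangentSpace (𝓡 2) z) z
      (constField u z)) z := by
  rw [mdifferentiableAt_section]
  simpa [constField] using mdifferentiableAt_const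

open VectorField in
lemma mpullback_constField {p₀ q : M} (hq : q ∈ (chartAt Plane p₀).source) (u : Plane) :
    mpullback (𝓡 2) (𝓡 2) (chartAt Plane p₀) (constField u) q = coordVector p₀ (fun _ ↦ u) q := by
  rw [mpullback_apply, ← chartDiff_eq_mfderiv hq]
  have h : (chartDiff p₀ q).inverse = chartDiffSymm p₀ q :=
    ContinuousLinearMap.inverse_equiv (chartDiffEquiv hq)
  exact congr($h u)

open VectorField in
-- Both fields are pull-backs of constant fields by the chart, and pull-back commutes with the
-- bracket. This removes the bracket term from the torsion of coordinate fields.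
lemma mlieBracket_coordVector_const {p₀ q : M} (hq : q ∈ (chartAt Plane p₀).source) (u w : Plane) :
    mlieBracket (𝓡 2) (coordVector p₀ fun _ ↦ u) (coordVector p₀ fun _ ↦ w) q = 0 := by
  have : IsManifold (𝓡 2) (minSmoothness ℝ 2) M :=
    IsManifold.of_le (n := ∞) (by simpa using two_le_infty)
  have : IsManifold (𝓡 2) (minSmoothness ℝ 2) Plane :=
    IsManifold.of_le (n := ∞) (by simpa using two_le_infty)
  have hc (u : Plane) : coordVector p₀ (fun _ ↦ u) =ᶠ[𝓝 q]
      mpullback (𝓡 2) (𝓡 2) (chartAt Plane p₀) (constField u) := by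
    filter_upwards [eventually_mem_chart_source hq] with q' hq'
    exact (mpullback_constField hq' u).symm
  rw [Filter.EventuallyEq.mlieBracket_vectorField_eq (hc u) (hc w),
    ← mpullback_mlieBracket (mdifferentiableAt_constField u _) (mdifferentiableAt_constField w _)
      (contMDiffAt_chart hq) (by simpa using two_le_infty)]
  have h0 : mlieBracket (𝓡 2) (constField u) (constField w) (chartAt Plane p₀ q) = 0 := by
    rw [← mlieBracketWithin_univ, mlieBracketWithin_eq_lieBracketWithin]
    unfold constField
    simp [lieBracket]
    rfl
  rw [mpullback_apply, h0, map_zero]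

omit [IsManifold (𝓡 2) ∞ M] in
lemma mvfderiv_congr_of_eventuallyEq {f g : M → ℝ} {q : M} (h : f =ᶠ[𝓝 q] g) :
    mvfderiv (𝓡 2) f q = mvfderiv (𝓡 2) g q := by
  ext v
  have := h.mfderiv_eq (I := 𝓡 2) (I' := 𝓘(ℝ, ℝ))
  exact congr($this v)

lemma mvfderiv_coordCovector_coordVector {p₀ q : M} (hq : q ∈ (chartAt Plane p₀).source)
    {ξ : Plane → PlaneDual} (hξ : DifferentiableAt ℝ ξ (chartAt Plane p₀ q))
    {X : Plane → Plane} (hX : DifferentiableAt ℝ X (chartAt Plane p₀ q))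
    (v : TangentSpace (𝓡 2) q) :
    mvfderiv (𝓡 2) (fun q ↦ coordCovector p₀ ξ q (coordVector p₀ X q)) q v
      = fderiv ℝ (fun z ↦ ξ z (X z)) (chartAt Plane p₀ q) (chartDiff p₀ q v) := by
  rw [← mvfderiv_comp_chart hq (hξ.clm_apply hX)]
  refine congr($(mvfderiv_congr_of_eventuallyEq ?_) v)
  filter_upwards [eventually_mem_chart_source hq] with q' hq'
  exact coordCovector_coordVector hq' ξ X

/-! ### Parallel covector fields, torsion and the Wagner condition -/

/-- The coordinate expression of a covector field is parallel at `q`. -/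
def ParallelAt (D : LinearConnection M) (p₀ : M) (ξ : Plane → PlaneDual) (q : M) : Prop :=
  ∀ v, covectorDeriv D (coordCovector p₀ ξ) q v = 0

lemma ParallelAt.apply_deriv {D : LinearConnection M} {p₀ q : M}
    {ξ : Plane → PlaneDual} (h : ParallelAt D p₀ ξ q) (hq : q ∈ (chartAt Plane p₀).source)
    (hξ : DifferentiableAt ℝ ξ (chartAt Plane p₀ q))
    {X : Plane → Plane} (hX : DifferentiableAt ℝ X (chartAt Plane p₀ q))
    (v : TangentSpace (𝓡 2) q) :
    coordCovector p₀ ξ q (D (coordVector p₀ X) q v)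
      = fderiv ℝ (fun z ↦ ξ z (X z)) (chartAt Plane p₀ q) (chartDiff p₀ q v) := by
  have h1 := covectorDeriv_apply D (diffCovectorAt_coord hq hξ) v (diffVectorAt_coord hq hX)
  rw [h v, mvfderiv_coordCovector_coordVector hq hξ hX] at h1
  exact (sub_eq_zero.1 h1.symm).symm

/-- First structure equation for a parallel form, `ξ ∘ T = dξ`. On commuting constant fields `T(u,
w) = ∇_u w - ∇_w u`, and `ξ(∇_u w) = u(ξ(w))` because `∇ξ = 0`. -/
lemma ParallelAt.apply_torsion {D : LinearConnection M} {p₀ q : M}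
    {ξ : Plane → PlaneDual} (h : ParallelAt D p₀ ξ q) (hq : q ∈ (chartAt Plane p₀).source)
    (hξ : DifferentiableAt ℝ ξ (chartAt Plane p₀ q)) (u w : Plane) :
    coordCovector p₀ ξ q (D.torsion q (chartDiffSymm p₀ q u) (chartDiffSymm p₀ q w))
      = (u 0 * w 1 - u 1 * w 0) * curl ξ (chartAt Plane p₀ q) := by
  have hd (u : Plane) := diffVectorAt_coord hq (differentiableAt_const (𝕜 := ℝ) u)
  have ht := D.torsion_apply (hd u) (hd w)
  rw [mlieBracket_coordVector_const hq, sub_zero] at ht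
  have hf (u w : Plane) : coordCovector p₀ ξ q
      (D (coordVector p₀ fun _ ↦ w) q (coordVector p₀ (fun _ ↦ u) q))
      = fderiv ℝ ξ (chartAt Plane p₀ q) u w := by
    rw [h.apply_deriv hq hξ (differentiableAt_const w), coordVector, chartDiff_chartDiffSymm hq,
      fderiv_clm_apply hξ (differentiableAt_const w)]
    simp
  rw [← fderiv_sub_eq_curl, ← hf, ← hf, ← map_sub, ← ht]
  rfl

/-- The coordinate expression of the symbol `σ` in the preferred chart at `p₀`. -/
def coordSymbol (σ : Symbol M) (p₀ : M) (z : Plane) : FourVector Plane :=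
  (σ.val ((chartAt Plane p₀).symm z)).map (chartDiff p₀ ((chartAt Plane p₀).symm z))

lemma coordSymbol_chart (σ : Symbol M) {p₀ q : M} (hq : q ∈ (chartAt Plane p₀).source) :
    coordSymbol σ p₀ (chartAt Plane p₀ q) = (σ.val q).map (chartDiff p₀ q) :=
  congrArg (fun q ↦ (σ.val q).map (chartDiff p₀ q)) ((chartAt Plane p₀).left_inv hq)

lemma coordSymbol_isRegular {σ : Symbol M} (hσ : σ.IsRegular) {p₀ q : M}
    (hq : q ∈ (chartAt Plane p₀).source) :
    (coordSymbol σ p₀ (chartAt Plane p₀ q)).IsRegular := by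
  rw [coordSymbol_chart σ hq]
  exact (hσ q).map (chartDiffEquiv hq)

lemma form_coordCovector (σ : Symbol M) {p₀ q : M} (hq : q ∈ (chartAt Plane p₀).source)
    (α : Fin 4 → Plane → PlaneDual) :
    (σ.val q).form (fun i ↦ coordCovector p₀ (α i) q)
      = (coordSymbol σ p₀ (chartAt Plane p₀ q)).form fun i ↦ α i (chartAt Plane p₀ q) := by
  rw [coordSymbol_chart σ hq]
  rfl

lemma contDiffOn_coordSymbol (σ : Symbol M) (p₀ : M) :
    ContDiffOn ℝ ∞ (fun z ↦ (coordSymbol σ p₀ z).coeffs (stdCovec 0) (stdCovec 1))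
      (chartAt Plane p₀).target := by
  rw [contDiffOn_pi]
  intro k z hz
  refine ContDiffAt.contDiffWithinAt ?_
  have hq := (chartAt Plane p₀).map_target hz
  have hz' := (chartAt Plane p₀).right_inv hz
  have h1 := σ.smooth ((chartAt Plane p₀).symm z)
    (fun i ↦ coordCovector p₀ fun _ ↦ stdCovec (FourVector.slot k i))
    fun i ↦ smoothCovectorAt_coord hq contDiffAt_const
  have h2 := ContMDiffAt.comp z h1
    ((contMDiffOn_chart_symm (I := 𝓡 2) (n := ∞) (x := p₀)).contMDiffAt ((chartAt Plane p₀).open_target.mem_nhds hz))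
  refine (contMDiffAt_iff_contDiffAt.1 h2).congr_of_eventuallyEq ?_
  filter_upwards [(chartAt Plane p₀).open_target.mem_nhds hz] with y hy
  rw [FourVector.coeffs_eq_slot]
  rfl

/-- This is the Leibniz rule for `σ(θ, θ, θ, θ)`: the Wagner condition removes the term `∇σ`, and
only the covariant derivatives of the coframe remain. -/
lemma fderiv_coeffs_coordSymbol {σ : Symbol M} {D : LinearConnection M}
    (hD : σ.IsWagnerConnection D) {p₀ q : M} (hq : q ∈ (chartAt Plane p₀).source)
    {θ : Plane → Fin 2 → PlaneDual}
    (hθ : DifferentiableAt ℝ θ (chartAt Plane p₀ q))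
    (hc : DifferentiableAt ℝ (fun z ↦ (coordSymbol σ p₀ z).coeffs (θ z 0) (θ z 1))
      (chartAt Plane p₀ q))
    (v : TangentSpace (𝓡 2) q) :
    fderiv ℝ (fun z ↦ (coordSymbol σ p₀ z).coeffs (θ z 0) (θ z 1)) (chartAt Plane p₀ q)
        (chartDiff p₀ q v)
      = (coordSymbol σ p₀ (chartAt Plane p₀ q)).coeffsDeriv (θ (chartAt Plane p₀ q))
        fun j ↦ (covectorDeriv D (coordCovector p₀ fun z ↦ θ z j) q v).comp
          (chartDiffSymm p₀ q) := by
  ext k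
  have hθ' (j) : DifferentiableAt ℝ (fun z ↦ θ z j) (chartAt Plane p₀ q) :=
    differentiableAt_pi.1 hθ j
  have h := hD q v (fun i ↦ coordCovector p₀ fun z ↦ θ z (FourVector.slot k i))
    fun i ↦ diffCovectorAt_coord hq (hθ' _)
  have hc' := differentiableAt_pi.1 hc k
  have e : (fun q ↦ (σ.val q).form fun i ↦
      coordCovector p₀ (fun z ↦ θ z (FourVector.slot k i)) q) =ᶠ[𝓝 q]
      fun q ↦ (coordSymbol σ p₀ (chartAt Plane p₀ q)).coeffs (θ (chartAt Plane p₀ q) 0)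
        (θ (chartAt Plane p₀ q) 1) k := by
    filter_upwards [eventually_mem_chart_source hq] with q' hq'
    rw [form_coordCovector σ hq', FourVector.coeffs_eq_slot]
  rw [Symbol.covDeriv, mvfderiv_congr_of_eventuallyEq e,
    mvfderiv_comp_chart (g := fun z ↦ (coordSymbol σ p₀ z).coeffs (θ z 0) (θ z 1) k) hq hc',
    sub_eq_zero] at h
  have hk := (hasFDerivAt_pi'.1 hc.hasFDerivAt k).fderiv
  rw [hk] at h
  refine h.trans ?_
  rw [FourVector.coeffsDeriv]
  refine Finset.sum_congr rfl fun i _ ↦ ?_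
  rw [coordSymbol_chart σ hq, FourVector.map_form]
  congr 1
  ext j : 1
  by_cases hj : j = i
  · subst hj
    ext w
    simp [chartDiffSymm_chartDiff hq]
  · simp [hj, coordCovector]

lemma eq_zero_of_wedge_ne_zero {θ : Fin 2 → PlaneDual} (hθ : wedge (θ 0) (θ 1) ≠ 0) {v : Plane}
    (h : ∀ j, θ j v = 0) : v = 0 := by
  have h0 := h 0
  have h1 := h 1
  rw [planeDual_apply] at h0 h1
  ext i
  refine (mul_eq_zero.1 ?_).resolve_left hθ
  unfold wedge
  fin_cases i <;> simp only [Fin.zero_eta, Fin.mk_one]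
  · linear_combination θ 1 (stdVec 1) * h0 - θ 0 (stdVec 1) * h1
  · linear_combination θ 0 (stdVec 0) * h1 - θ 1 (stdVec 0) * h0

/-- The basis of the plane dual to a basis of covectors. -/
def dualVec (θ : Fin 2 → PlaneDual) : Fin 2 → Plane :=
  ![(wedge (θ 0) (θ 1))⁻¹ • (θ 1 (stdVec 1) • stdVec 0 - θ 1 (stdVec 0) • stdVec 1),
    (wedge (θ 0) (θ 1))⁻¹ • (θ 0 (stdVec 0) • stdVec 1 - θ 0 (stdVec 1) • stdVec 0)]

lemma apply_dualVec {θ : Fin 2 → PlaneDual} (hθ : wedge (θ 0) (θ 1) ≠ 0) (i j : Fin 2) :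
    θ j (dualVec θ i) = if j = i then 1 else 0 := by
  fin_cases i <;> fin_cases j <;> simp [dualVec]
  · field_simp
    rw [wedge]
    ring
  · exact .inr (by ring)
  · exact .inr (by ring)
  · field_simp
    rw [wedge]

lemma det_dualVec {θ : Fin 2 → PlaneDual} (hθ : wedge (θ 0) (θ 1) ≠ 0) :
    dualVec θ 0 0 * dualVec θ 1 1 - dualVec θ 0 1 * dualVec θ 1 0 = (wedge (θ 0) (θ 1))⁻¹ := by
  simp [dualVec, stdVec_apply]
  field_simp
  simp only [wedge]
  ring

lemma contDiffAt_wedge {θ : Plane → Fin 2 → PlaneDual} {z : Plane} (hθ : ContDiffAt ℝ ∞ θ z) :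
    ContDiffAt ℝ ∞ (fun z ↦ wedge (θ z 0) (θ z 1)) z := by
  have h (j l) : ContDiffAt ℝ ∞ (fun z ↦ θ z j (stdVec l)) z :=
    (contDiffAt_pi.1 hθ j).clm_apply contDiffAt_const
  exact ((h 0 0).mul (h 1 1)).sub ((h 0 1).mul (h 1 0))

lemma contDiffAt_curl {ν : Plane → PlaneDual} {z : Plane} (hν : ContDiffAt ℝ ∞ ν z) :
    ContDiffAt ℝ ∞ (curl ν) z := by
  have h := hν.fderiv_right (m := ∞) (by simp)
  exact ((h.clm_apply contDiffAt_const).clm_apply contDiffAt_const).sub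
    ((h.clm_apply contDiffAt_const).clm_apply contDiffAt_const)

lemma contDiffAt_dualVec {θ : Plane → Fin 2 → PlaneDual} {z : Plane} (hθ : ContDiffAt ℝ ∞ θ z)
    (hw : wedge (θ z 0) (θ z 1) ≠ 0) (i : Fin 2) :
    ContDiffAt ℝ ∞ (fun z ↦ dualVec (θ z) i) z := by
  have h (j l) : ContDiffAt ℝ ∞ (fun z ↦ θ z j (stdVec l)) z :=
    (contDiffAt_pi.1 hθ j).clm_apply contDiffAt_const
  have hw' := (contDiffAt_wedge hθ).inv hw
  fin_cases i
  · exact hw'.smul (((h 1 1).smul contDiffAt_const).sub ((h 1 0).smul contDiffAt_const))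
  · exact hw'.smul (((h 0 0).smul contDiffAt_const).sub ((h 0 1).smul contDiffAt_const))

lemma FourVector.coeffsDeriv_zero (S : FourVector Plane) (θ : Fin 2 → PlaneDual) :
    S.coeffsDeriv θ 0 = 0 := by
  rw [← coeffsDerivL_apply, map_zero]

/-- Constancy of `L (coefficients)` to first order says that `L ∘ coeffsDeriv` kills `∇_v θ`, and
injectivity finishes. `L` is the projection from the implicit function theorem when a coframe is
constructed, and the identity when all five coefficients are already known to be constant. -/
lemma parallelAt_of_fderiv_coeffs_eq_zero {σ : Symbol M} {D : LinearConnection M}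
    (hD : σ.IsWagnerConnection D) {p₀ q : M} (hq : q ∈ (chartAt Plane p₀).source)
    {θ : Plane → Fin 2 → PlaneDual} (hθ : DifferentiableAt ℝ θ (chartAt Plane p₀ q))
    (hc : DifferentiableAt ℝ (fun z ↦ (coordSymbol σ p₀ z).coeffs (θ z 0) (θ z 1))
      (chartAt Plane p₀ q))
    {W : Type*} [NormedAddCommGroup W] [NormedSpace ℝ W] (L : (Fin 5 → ℝ) →L[ℝ] W)
    (hL : ∀ θ', L ((coordSymbol σ p₀ (chartAt Plane p₀ q)).coeffsDeriv
      (θ (chartAt Plane p₀ q)) θ') = 0 → θ' = 0)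
    (h0 : fderiv ℝ (fun z ↦ L ((coordSymbol σ p₀ z).coeffs (θ z 0) (θ z 1)))
      (chartAt Plane p₀ q) = 0) (j : Fin 2) :
    ParallelAt D p₀ (fun z ↦ θ z j) q := by
  intro v
  have h1 : L (fderiv ℝ (fun z ↦ (coordSymbol σ p₀ z).coeffs (θ z 0) (θ z 1))
      (chartAt Plane p₀ q) (chartDiff p₀ q v)) = 0 := by
    have := (L.hasFDerivAt.comp (chartAt Plane p₀ q) hc.hasFDerivAt).fderiv
    exact congr($(this.symm.trans h0) (chartDiff p₀ q v))
  rw [fderiv_coeffs_coordSymbol hD hq hθ hc] at h1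
  have h2 := congrFun (hL _ h1) j
  ext w
  simpa [chartDiffSymm_chartDiff hq] using congr($h2 (chartDiff p₀ q w))

/-! ### Parallel coframes and constancy of their torsion coefficients -/

/-- A coframe on the convex open subset `s` of the target of the preferred chart at `p₀` that is
parallel with respect to `D`. -/
structure ParallelCoframe (D : LinearConnection M) (p₀ : M) (s : Set Plane)
    (θ : Plane → Fin 2 → PlaneDual) : Prop where
  isOpen : IsOpen s
  convex : Convex ℝ s
  subset : s ⊆ (chartAt Plane p₀).target
  contDiffOn : ContDiffOn ℝ ∞ θ s
  wedge_ne_zero : ∀ z ∈ s, wedge (θ z 0) (θ z 1) ≠ 0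
  parallel : ∀ q ∈ (chartAt Plane p₀).source, chartAt Plane p₀ q ∈ s →
    ∀ j, ParallelAt D p₀ (fun z ↦ θ z j) q

lemma exists_parallelCoframe {σ : Symbol M} (hσ : σ.IsRegular) {D : LinearConnection M}
    (hD : σ.IsWagnerConnection D) (p₀ : M) :
    ∃ s θ, chartAt Plane p₀ p₀ ∈ s ∧ ParallelCoframe D p₀ s θ := by
  obtain ⟨θ, L, h⟩ := FourVector.exists_implicit_coframe (chartAt Plane p₀).open_target
    (mem_chart_target Plane p₀) (coordSymbol_isRegular hσ (mem_chart_source Plane p₀))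
    (contDiffOn_coordSymbol σ p₀)
  obtain ⟨r, hr, hball⟩ := Metric.eventually_nhds_iff_ball.1
    (h.and ((chartAt Plane p₀).open_target.mem_nhds (mem_chart_target Plane p₀)))
  refine ⟨Metric.ball (chartAt Plane p₀ p₀) r, θ, Metric.mem_ball_self hr, Metric.isOpen_ball,
    convex_ball _ _, fun z hz ↦ (hball z hz).2, fun z hz ↦ (hball z hz).1.1.contDiffWithinAt,
    fun z hz ↦ (hball z hz).1.2.1, fun q hq hz ↦ ?_⟩
  obtain ⟨h1, -, h3, h4, h5⟩ := (hball _ hz).1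
  exact parallelAt_of_fderiv_coeffs_eq_zero hD hq (h1.differentiableAt (by simp)) h4 L h3 h5

namespace ParallelCoframe

variable {D : LinearConnection M} {p₀ : M} {s : Set Plane} {θ : Plane → Fin 2 → PlaneDual}

lemma contDiffAt (h : ParallelCoframe D p₀ s θ) {z : Plane} (hz : z ∈ s) : ContDiffAt ℝ ∞ θ z :=
  h.contDiffOn.contDiffAt (h.isOpen.mem_nhds hz)

lemma contDiffAt_apply (h : ParallelCoframe D p₀ s θ) {z : Plane} (hz : z ∈ s) (j : Fin 2) :
    ContDiffAt ℝ ∞ (fun z ↦ θ z j) z :=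
  contDiffAt_pi.1 (h.contDiffAt hz) j

lemma differentiableAt_apply (h : ParallelCoframe D p₀ s θ) {z : Plane} (hz : z ∈ s) (j : Fin 2) :
    DifferentiableAt ℝ (fun z ↦ θ z j) z :=
  (h.contDiffAt_apply hz j).differentiableAt (by simp)

lemma eq_of_fderiv_eq_zero (h : ParallelCoframe D p₀ s θ) {F : Type*} [NormedAddCommGroup F]
    [NormedSpace ℝ F] {g : Plane → F} (hg : ∀ z ∈ s, DifferentiableAt ℝ g z)
    (h0 : ∀ q ∈ (chartAt Plane p₀).source, chartAt Plane p₀ q ∈ s → ∀ v,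
      fderiv ℝ g (chartAt Plane p₀ q) (chartDiff p₀ q v) = 0) {z z' : Plane} (hz : z ∈ s)
    (hz' : z' ∈ s) : g z = g z' := by
  refine h.isOpen.is_const_of_fderiv_eq_zero h.convex.isPreconnected
    (fun z hz ↦ (hg z hz).differentiableWithinAt) (fun z hz ↦ ?_) hz hz'
  have hq := (chartAt Plane p₀).map_target (h.subset hz)
  have hz' := (chartAt Plane p₀).right_inv (h.subset hz)
  ext w
  have := h0 _ hq (by rwa [hz']) (chartDiffSymm p₀ _ w)
  rw [chartDiff_chartDiffSymm hq, hz'] at this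
  exact this

/-- With `∇θ = 0` the Leibniz rule leaves no term, so all five coefficients are constant, including
the direction not controlled by `L`. -/
lemma coeffs_const (h : ParallelCoframe D p₀ s θ) {σ : Symbol M} (hD : σ.IsWagnerConnection D)
    {z z' : Plane} (hz : z ∈ s) (hz' : z' ∈ s) :
    (coordSymbol σ p₀ z).coeffs (θ z 0) (θ z 1) = (coordSymbol σ p₀ z').coeffs (θ z' 0) (θ z' 1) := by
  have hd : ∀ z ∈ s, DifferentiableAt ℝ
      (fun z ↦ (coordSymbol σ p₀ z).coeffs (θ z 0) (θ z 1)) z := fun z hz ↦ by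
    have hG := FourVector.contDiffOn_coeffs (contDiffOn_coordSymbol σ p₀)
    have hO : IsOpen ((chartAt Plane p₀).target ×ˢ (univ : Set (Fin 2 → PlaneDual))) :=
      (chartAt Plane p₀).open_target.prod isOpen_univ
    exact ((hG.contDiffAt (hO.mem_nhds ⟨h.subset hz, mem_univ (θ z)⟩)).comp z
      (contDiffAt_id.prodMk (h.contDiffAt hz))).differentiableAt (by simp)
  refine h.eq_of_fderiv_eq_zero (g := fun z ↦ (coordSymbol σ p₀ z).coeffs (θ z 0) (θ z 1)) hd
    (fun q hq hqs v ↦ ?_) hz hz'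
  rw [fderiv_coeffs_coordSymbol hD hq ((h.contDiffAt hqs).differentiableAt (by simp)) (hd _ hqs)]
  have h0 : (fun j ↦ (covectorDeriv D (coordCovector p₀ fun z ↦ θ z j) q v).comp
      (chartDiffSymm p₀ q)) = 0 := by
    ext j : 1
    rw [h.parallel q hq hqs j v]
    rfl
  rw [h0, FourVector.coeffsDeriv_zero]

lemma eq_zero (h : ParallelCoframe D p₀ s θ) {q : M} (hq : q ∈ (chartAt Plane p₀).source)
    (hqs : chartAt Plane p₀ q ∈ s) {v : TangentSpace (𝓡 2) q}
    (hv : ∀ j, coordCovector p₀ (fun z ↦ θ z j) q v = 0) : v = 0 := by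
  have h0 : chartDiff p₀ q v = 0 := eq_zero_of_wedge_ne_zero (h.wedge_ne_zero _ hqs) hv
  rw [← chartDiffSymm_chartDiff hq v, h0, map_zero]

lemma torsion_eq_zero_iff (h : ParallelCoframe D p₀ s θ) {q : M}
    (hq : q ∈ (chartAt Plane p₀).source) (hqs : chartAt Plane p₀ q ∈ s) :
    D.torsion q = 0 ↔ ∀ j, curl (fun z ↦ θ z j) (chartAt Plane p₀ q) = 0 := by
  constructor
  · intro ht j
    have := (h.parallel q hq hqs j).apply_torsion hq (h.differentiableAt_apply hqs j) (stdVec 0)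
      (stdVec 1)
    rw [ht] at this
    simpa [stdVec_apply] using this.symm
  · intro hc
    ext u w : 2
    refine h.eq_zero hq hqs fun j ↦ ?_
    rw [← chartDiffSymm_chartDiff hq u, ← chartDiffSymm_chartDiff hq w,
      (h.parallel q hq hqs j).apply_torsion hq (h.differentiableAt_apply hqs j), hc, mul_zero]

/-- The pairings of the dual frame with the parallel coframe are constants, so the coframe
annihilates `∇_v` of each frame field. -/
lemma deriv_dualVec (h : ParallelCoframe D p₀ s θ) {q : M} (hq : q ∈ (chartAt Plane p₀).source)
    (hqs : chartAt Plane p₀ q ∈ s) (i : Fin 2) (v : TangentSpace (𝓡 2) q) :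
    D (coordVector p₀ fun z ↦ dualVec (θ z) i) q v = 0 := by
  refine h.eq_zero hq hqs fun j ↦ ?_
  rw [(h.parallel q hq hqs j).apply_deriv hq (h.differentiableAt_apply hqs j)
    ((contDiffAt_dualVec (h.contDiffAt hqs) (h.wedge_ne_zero _ hqs) i).differentiableAt (by simp))]
  have e : (fun z ↦ θ z j (dualVec (θ z) i)) =ᶠ[𝓝 (chartAt Plane p₀ q)]
      fun _ ↦ if j = i then 1 else 0 := by
    filter_upwards [h.isOpen.mem_nhds hqs] with z hz
    exact apply_dualVec (h.wedge_ne_zero z hz) i j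
  rw [e.fderiv_eq]
  simp

lemma torsion_dualVec (h : ParallelCoframe D p₀ s θ) {q : M}
    (hq : q ∈ (chartAt Plane p₀).source) (hqs : chartAt Plane p₀ q ∈ s) (j : Fin 2) :
    coordCovector p₀ (fun z ↦ θ z j) q
      (D.torsion q (coordVector p₀ (fun z ↦ dualVec (θ z) 0) q)
        (coordVector p₀ (fun z ↦ dualVec (θ z) 1) q))
      = curl (fun z ↦ θ z j) (chartAt Plane p₀ q)
        / wedge (θ (chartAt Plane p₀ q) 0) (θ (chartAt Plane p₀ q) 1) := by
  rw [coordVector, coordVector, (h.parallel q hq hqs j).apply_torsion hq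
    (h.differentiableAt_apply hqs j), det_dualVec (h.wedge_ne_zero _ hqs)]
  ring

lemma contDiffAt_curl_div (h : ParallelCoframe D p₀ s θ) {z : Plane} (hz : z ∈ s) (j : Fin 2) :
    ContDiffAt ℝ ∞ (fun z ↦ curl (fun z ↦ θ z j) z / wedge (θ z 0) (θ z 1)) z :=
  (contDiffAt_curl (h.contDiffAt_apply hz j)).div (contDiffAt_wedge (h.contDiffAt hz))
    (h.wedge_ne_zero z hz)

/-- Evaluated on the parallel dual frame `X₀, X₁`, the condition `∇T = 0` says that the vector field
`T(X₀, X₁)` is parallel. Its components in the parallel coframe, which are the quotients `t j`, are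
therefore constant. -/
lemma exists_curl_eq (h : ParallelCoframe D p₀ s θ) (hT : HasParallelTorsion D) :
    ∃ t : Fin 2 → ℝ, ∀ z ∈ s, ∀ j,
      curl (fun z ↦ θ z j) z = t j * wedge (θ z 0) (θ z 1) := by
  let t (j : Fin 2) (z : Plane) : ℝ := curl (fun z ↦ θ z j) z / wedge (θ z 0) (θ z 1)
  have hX {z : Plane} (hz : z ∈ s) (i : Fin 2) :=
    contDiffAt_dualVec (h.contDiffAt hz) (h.wedge_ne_zero _ hz) i
  suffices H : ∀ j, ∀ z ∈ s, ∀ z' ∈ s, t j z = t j z' by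
    rcases s.eq_empty_or_nonempty with rfl | ⟨z₀, hz₀⟩
    · exact ⟨0, by simp⟩
    · refine ⟨fun j ↦ t j z₀, fun z hz j ↦ ?_⟩
      change _ = t j z₀ * _
      rw [← H j z hz z₀ hz₀, div_mul_cancel₀ _ (h.wedge_ne_zero z hz)]
  intro j z hz z' hz'
  refine h.eq_of_fderiv_eq_zero (g := t j)
    (fun z hz ↦ (h.contDiffAt_curl_div hz j).differentiableAt (by simp))
    (fun q hq hqs v ↦ ?_) hz hz'
  have hd (i) := diffVectorAt_coord hq ((hX hqs i).differentiableAt (by simp))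
  have hpar := hT q v _ _ (hd 0) (hd 1)
  rw [h.deriv_dualVec hq hqs, h.deriv_dualVec hq hqs, map_zero, map_zero, sub_zero,
    zero_apply, sub_zero] at hpar
  have hnear : ∀ᶠ q' in 𝓝 q, q' ∈ (chartAt Plane p₀).source ∧ chartAt Plane p₀ q' ∈ s :=
    (eventually_mem_chart_source hq).and
      (((chartAt Plane p₀).continuousAt hq).eventually (h.isOpen.mem_nhds hqs))
  -- The expression `T(X₀, X₁) = t₀ X₀ + t₁ X₁` serves to show that this field is differentiable, as
  -- the formula for the dual connection requires.
  let Y : Plane → Plane := fun z ↦ t 0 z • dualVec (θ z) 0 + t 1 z • dualVec (θ z) 1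
  have hY : DifferentiableAt ℝ Y (chartAt Plane p₀ q) :=
    (((h.contDiffAt_curl_div hqs 0).smul (hX hqs 0)).add
      ((h.contDiffAt_curl_div hqs 1).smul (hX hqs 1))).differentiableAt (by simp)
  let τ : (q : M) → TangentSpace (𝓡 2) q := fun q ↦
    D.torsion q (coordVector p₀ (fun z ↦ dualVec (θ z) 0) q)
      (coordVector p₀ (fun z ↦ dualVec (θ z) 1) q)
  have hτ : ∀ q ∈ (chartAt Plane p₀).source, chartAt Plane p₀ q ∈ s →
      τ q = coordVector p₀ Y q := by
    intro q hq hqs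
    rw [← sub_eq_zero]
    refine h.eq_zero hq hqs fun j ↦ ?_
    rw [map_sub, h.torsion_dualVec hq hqs, coordCovector_coordVector hq]
    have ha (i) := apply_dualVec (h.wedge_ne_zero _ hqs) i j
    simp only [Y, map_add, map_smul, ha]
    fin_cases j <;> simp [t]
  have hτd : DiffVectorAt τ q := by
    refine MDifferentiableAt.congr_of_eventuallyEq (diffVectorAt_coord hq hY) ?_
    filter_upwards [hnear] with q' hq'
    rw [hτ q' hq'.1 hq'.2]
  have hcov := covectorDeriv_apply D (diffCovectorAt_coord hq (h.differentiableAt_apply hqs j)) v hτd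
  have e : (fun q ↦ coordCovector p₀ (fun z ↦ θ z j) q (τ q)) =ᶠ[𝓝 q]
      fun q ↦ t j (chartAt Plane p₀ q) := by
    filter_upwards [hnear] with q' hq'
    exact h.torsion_dualVec hq'.1 hq'.2 j
  rw [h.parallel q hq hqs j v, hpar, map_zero, sub_zero, mvfderiv_congr_of_eventuallyEq e,
    mvfderiv_comp_chart hq ((h.contDiffAt_curl_div hqs j).differentiableAt (by simp))] at hcov
  exact hcov.symm

end ParallelCoframe

lemma ParallelAt.combination {D : LinearConnection M} {p₀ q : M}
    (hq : q ∈ (chartAt Plane p₀).source) {θ : Plane → Fin 2 → PlaneDual}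
    (hθ : ∀ j, DifferentiableAt ℝ (fun z ↦ θ z j) (chartAt Plane p₀ q))
    (h : ∀ j, ParallelAt D p₀ (fun z ↦ θ z j) q) (a : Fin 2 → ℝ) :
    ParallelAt D p₀ (fun z ↦ ∑ l, a l • θ z l) q := by
  intro v
  have hd : DifferentiableAt ℝ (fun z ↦ ∑ l, a l • θ z l) (chartAt Plane p₀ q) :=
    DifferentiableAt.fun_sum fun l _ ↦ (hθ l).const_smul (a l)
  ext w
  have hw : coordVector p₀ (fun _ ↦ chartDiff p₀ q w) q = w := chartDiffSymm_chartDiff hq w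
  have hX := differentiableAt_const (𝕜 := ℝ) (x := chartAt Plane p₀ q) (chartDiff p₀ q w)
  have h1 := covectorDeriv_apply D (diffCovectorAt_coord hq hd) v (diffVectorAt_coord hq hX)
  rw [mvfderiv_coordCovector_coordVector hq hd hX, hw] at h1
  rw [h1, zero_apply, sub_eq_zero]
  have h2 (l) := (h l).apply_deriv hq (hθ l) hX v
  have h3 : fderiv ℝ (fun z ↦ (∑ l, a l • θ z l) (chartDiff p₀ q w)) (chartAt Plane p₀ q)
      = ∑ l, a l • fderiv ℝ (fun z ↦ θ z l (chartDiff p₀ q w)) (chartAt Plane p₀ q) := by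
    simp only [sum_apply, smul_apply, smul_eq_mul]
    rw [fderiv_fun_sum fun l _ ↦ ((hθ l).clm_apply hX).const_mul (a l)]
    refine Finset.sum_congr rfl fun l _ ↦ ?_
    rw [fderiv_const_mul ((hθ l).clm_apply hX)]
  rw [h3]
  simp only [sum_apply, smul_apply, ← h2, coordCovector, ContinuousLinearMap.comp_apply]

lemma wedge_combination (θ : Fin 2 → PlaneDual) (a b : Fin 2 → ℝ) :
    wedge (∑ l, a l • θ l) (∑ l, b l • θ l) = (a 0 * b 1 - a 1 * b 0) * wedge (θ 0) (θ 1) := by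
  simp [wedge]
  ring

lemma ParallelCoframe.combination {D : LinearConnection M} {p₀ : M} {s : Set Plane}
    {θ : Plane → Fin 2 → PlaneDual} (h : ParallelCoframe D p₀ s θ) {a : Fin 2 → Fin 2 → ℝ}
    (ha : a 0 0 * a 1 1 - a 0 1 * a 1 0 ≠ 0) :
    ParallelCoframe D p₀ s fun z j ↦ ∑ l, a j l • θ z l where
  isOpen := h.isOpen
  convex := h.convex
  subset := h.subset
  contDiffOn := by
    have hc := contDiffOn_pi.1 h.contDiffOn
    rw [contDiffOn_pi]
    exact fun j ↦ ContDiffOn.sum fun l _ ↦ (hc l).const_smul (a j l)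
  wedge_ne_zero z hz := by
    rw [wedge_combination]
    exact mul_ne_zero ha (h.wedge_ne_zero z hz)
  parallel q hq hqs j :=
    ParallelAt.combination hq (fun j ↦ h.differentiableAt_apply hqs j) (h.parallel q hq hqs) (a j)

lemma curl_combination {θ : Plane → Fin 2 → PlaneDual} {z : Plane}
    (hθ : ∀ j, DifferentiableAt ℝ (fun z ↦ θ z j) z) (a : Fin 2 → ℝ) :
    curl (fun z ↦ ∑ l, a l • θ z l) z
      = a 0 * curl (fun z ↦ θ z 0) z + a 1 * curl (fun z ↦ θ z 1) z := by
  have h (l) : curl (fun z ↦ a l • θ z l) z = a l * curl (fun z ↦ θ z l) z := by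
    rw [curl_smul (differentiableAt_const _) (hθ l)]
    simp [wedge]
  simp only [Fin.sum_univ_two]
  rw [curl_add (ν := fun z ↦ a 0 • θ z 0) (ν' := fun z ↦ a 1 • θ z 1) ((hθ 0).fun_const_smul _)
    ((hθ 1).fun_const_smul _), h, h]

/-! ### Normalizing the torsion and propagating the constants over the surface -/

/-- At the point `q` there is a basis `α` of covectors with `α₀ ∘ T = ε α₀ ∧ α₁`, `α₁ ∘ T = 0` in
which the symbol `σ` has the coefficients `c`. -/
def AdaptedAt (σ : Symbol M) (D : LinearConnection M) (ε : ℝ) (c : Fin 5 → ℝ) (q : M) : Prop :=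
  ∃ α : Fin 2 → (TangentSpace (𝓡 2) q →L[ℝ] ℝ), (∀ v, (∀ j, α j v = 0) → v = 0) ∧
    (∀ u w, α 0 (D.torsion q u w) = ε * (α 0 u * α 1 w - α 0 w * α 1 u)) ∧
    (∀ u w, α 1 (D.torsion q u w) = 0) ∧ (σ.val q).coeffs (α 0) (α 1) = c

/-- A parallel coframe with `dθ₀ = ε θ₀ ∧ θ₁` and `dθ₁ = 0`. -/
structure AdaptedCoframe (D : LinearConnection M) (ε : ℝ) (p₀ : M) (s : Set Plane)
    (θ : Plane → Fin 2 → PlaneDual) : Prop extends ParallelCoframe D p₀ s θ where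
  curl_zero : ∀ z ∈ s, curl (fun z ↦ θ z 0) z = ε * wedge (θ z 0) (θ z 1)
  curl_one : ∀ z ∈ s, curl (fun z ↦ θ z 1) z = 0

lemma wedge_mul_det (ξ η : PlaneDual) (u w : Plane) :
    (u 0 * w 1 - u 1 * w 0) * wedge ξ η = ξ u * η w - ξ w * η u := by
  rw [planeDual_apply ξ u, planeDual_apply η u, planeDual_apply ξ w, planeDual_apply η w, wedge]
  ring

lemma wedge_ne_zero_of_forall {θ : Fin 2 → PlaneDual} (h : ∀ v, (∀ j, θ j v = 0) → v = 0) :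
    wedge (θ 0) (θ 1) ≠ 0 := by
  intro hw
  have h1 := h (θ 1 (stdVec 1) • stdVec 0 - θ 1 (stdVec 0) • stdVec 1) fun j ↦ by
    rw [wedge] at hw
    fin_cases j <;> simp <;> linarith
  have h0 := h (θ 0 (stdVec 1) • stdVec 0 - θ 0 (stdVec 0) • stdVec 1) fun j ↦ by
    rw [wedge] at hw
    fin_cases j <;> simp <;> linarith
  have e (x y : ℝ) (hxy : x • stdVec 0 - y • stdVec 1 = 0) : x = 0 :=
    by simpa [stdVec_apply] using congr($hxy 0)
  have e' (x y : ℝ) (hxy : x • stdVec 0 - y • stdVec 1 = 0) : y = 0 :=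
    by simpa [stdVec_apply] using congr($hxy 1)
  have h2 := h (stdVec 0) fun j ↦ by
    fin_cases j
    exacts [e' _ _ h0, e' _ _ h1]
  simpa [stdVec_apply] using congr($h2 0)

lemma AdaptedCoframe.adaptedAt {σ : Symbol M} {D : LinearConnection M}
    {ε : ℝ} {p₀ : M} {s : Set Plane} {θ : Plane → Fin 2 → PlaneDual}
    (h : AdaptedCoframe D ε p₀ s θ) {q : M} (hq : q ∈ (chartAt Plane p₀).source)
    (hqs : chartAt Plane p₀ q ∈ s) :
    AdaptedAt σ D ε ((coordSymbol σ p₀ (chartAt Plane p₀ q)).coeffs (θ (chartAt Plane p₀ q) 0)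
      (θ (chartAt Plane p₀ q) 1)) q := by
  have ht (j) (u w : TangentSpace (𝓡 2) q) :=
    (h.parallel q hq hqs j).apply_torsion hq (h.differentiableAt_apply hqs j) (chartDiff p₀ q u)
      (chartDiff p₀ q w)
  simp only [chartDiffSymm_chartDiff hq] at ht
  refine ⟨fun j ↦ coordCovector p₀ (fun z ↦ θ z j) q, fun v hv ↦ h.eq_zero hq hqs hv,
    fun u w ↦ ?_, fun u w ↦ ?_, ?_⟩
  · rw [ht 0, h.curl_zero _ hqs, mul_left_comm, wedge_mul_det]
    rfl
  · rw [ht 1, h.curl_one _ hqs, mul_zero]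
  · rw [coordSymbol_chart σ hq, FourVector.map_coeffs]
    rfl

/-- A basis of covectors at one point extends to a parallel coframe by taking constant combinations
of a given one. The torsion constants of the new coframe can be read off at `q`, hence the normal
form holds on all of `s`. -/
lemma AdaptedAt.exists_adaptedCoframe {σ : Symbol M} {D : LinearConnection M}
    (hT : HasParallelTorsion D) {ε : ℝ} {c : Fin 5 → ℝ} {q : M} (hα : AdaptedAt σ D ε c q)
    {p₀ : M} {s : Set Plane} {θ : Plane → Fin 2 → PlaneDual} (h : ParallelCoframe D p₀ s θ)
    (hq : q ∈ (chartAt Plane p₀).source) (hqs : chartAt Plane p₀ q ∈ s) :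
    ∃ θ', AdaptedCoframe D ε p₀ s θ' ∧ (coordSymbol σ p₀ (chartAt Plane p₀ q)).coeffs
      (θ' (chartAt Plane p₀ q) 0) (θ' (chartAt Plane p₀ q) 1) = c := by
  obtain ⟨α, hα, hα0, hα1, rfl⟩ := hα
  choose a ha using fun j ↦ exists_combination (h.wedge_ne_zero _ hqs)
    ((α j).comp (chartDiffSymm p₀ q))
  have hαa (j) : α j = coordCovector p₀ (fun z ↦ ∑ l, a j l • θ z l) q := by
    ext v
    rw [coordCovector, ← ha j]
    simp [chartDiffSymm_chartDiff hq]
  have hdet : a 0 0 * a 1 1 - a 0 1 * a 1 0 ≠ 0 := by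
    have hα' := wedge_ne_zero_of_forall (θ := fun j ↦ (α j).comp (chartDiffSymm p₀ q)) fun v hv ↦ by
      have h0 : chartDiffSymm p₀ q v = 0 := hα _ hv
      rw [← chartDiff_chartDiffSymm hq v, h0, map_zero]
    simp only [ha, wedge_combination] at hα'
    exact left_ne_zero_of_mul hα'
  have h' := h.combination hdet
  obtain ⟨t, ht⟩ := h'.exists_curl_eq hT
  have hw := h'.wedge_ne_zero _ hqs
  have htor (j) := (h'.parallel q hq hqs j).apply_torsion hq (h'.differentiableAt_apply hqs j)
    (stdVec 0) (stdVec 1)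
  have hcurl (j) : α j (D.torsion q (chartDiffSymm p₀ q (stdVec 0))
      (chartDiffSymm p₀ q (stdVec 1))) = t j * wedge (∑ l, a 0 l • θ (chartAt Plane p₀ q) l)
        (∑ l, a 1 l • θ (chartAt Plane p₀ q) l) := by
    rw [hαa, htor j, ht _ hqs]
    simp [stdVec_apply]
  have hαs (j l) : α j (chartDiffSymm p₀ q (stdVec l))
      = (∑ m, a j m • θ (chartAt Plane p₀ q) m) (stdVec l) := by
    rw [← ha j]
    rfl
  have t0 : t 0 = ε := by
    have := hcurl 0
    rw [hα0, hαs, hαs, hαs, hαs] at this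
    refine mul_right_cancel₀ hw (this.symm.trans ?_)
    rw [wedge]
  have t1 : t 1 = 0 := by
    have := hcurl 1
    rw [hα1] at this
    exact (mul_eq_zero.1 this.symm).resolve_right hw
  refine ⟨_, ⟨h', fun z hz ↦ ?_, fun z hz ↦ ?_⟩, ?_⟩
  · rw [ht z hz, t0]
  · rw [ht z hz, t1, zero_mul]
  · rw [coordSymbol_chart σ hq, FourVector.map_coeffs, hαa 0, hαa 1]
    rfl

/-- Adaptedness with given `ε, c` passes between any two points of the domain of a parallel coframe.
Being symmetric in the two points, this makes the set of adapted points both open and closed. -/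
lemma exists_nhds_adaptedAt_imp {σ : Symbol M} (hσ : σ.IsRegular) {D : LinearConnection M}
    (hD : σ.IsWagnerConnection D) (hT : HasParallelTorsion D) (ε : ℝ) (c : Fin 5 → ℝ) (p : M) :
    ∃ U ∈ 𝓝 p, ∀ q ∈ U, ∀ q' ∈ U, AdaptedAt σ D ε c q → AdaptedAt σ D ε c q' := by
  obtain ⟨s, θ, hp, h⟩ := exists_parallelCoframe hσ hD p
  have hp' := mem_chart_source Plane p
  refine ⟨{q | q ∈ (chartAt Plane p).source ∧ chartAt Plane p q ∈ s},
    (eventually_mem_chart_source hp').and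
      (((chartAt Plane p).continuousAt hp').eventually (h.isOpen.mem_nhds hp)), ?_⟩
  rintro q ⟨hq, hqs⟩ q' ⟨hq', hqs'⟩ hα
  obtain ⟨θ', h', rfl⟩ := hα.exists_adaptedCoframe hT h hq hqs
  rw [h'.coeffs_const hD hqs hqs']
  exact h'.adaptedAt hq' hqs'

lemma adaptedAt_of_preconnectedSpace [PreconnectedSpace M] {σ : Symbol M} (hσ : σ.IsRegular)
    {D : LinearConnection M} (hD : σ.IsWagnerConnection D) (hT : HasParallelTorsion D) {ε : ℝ}
    {c : Fin 5 → ℝ} {p : M} (hp : AdaptedAt σ D ε c p) (q : M) : AdaptedAt σ D ε c q := by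
  have hclopen : IsClopen {q | AdaptedAt σ D ε c q} := by
    refine ⟨isClosed_iff_nhds.2 fun p hp ↦ ?_, isOpen_iff_mem_nhds.2 fun p hp ↦ ?_⟩
    · obtain ⟨U, hU, h⟩ := exists_nhds_adaptedAt_imp hσ hD hT ε c p
      obtain ⟨q, hqU, hq⟩ := hp U hU
      exact h q hqU p (mem_of_mem_nhds hU) hq
    · obtain ⟨U, hU, h⟩ := exists_nhds_adaptedAt_imp hσ hD hT ε c p
      exact mem_of_superset hU fun q hq ↦ h p (mem_of_mem_nhds hU) q hq hp
  exact eq_univ_iff_forall.1 (hclopen.eq_univ ⟨p, hp⟩) q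

lemma exists_adaptedAt {σ : Symbol M} (hσ : σ.IsRegular) {D : LinearConnection M}
    (hD : σ.IsWagnerConnection D) (hT : HasParallelTorsion D) (p : M) :
    (∃ c, AdaptedAt σ D 0 c p) ∨ ∃ c, AdaptedAt σ D 1 c p := by
  obtain ⟨s, θ, hp, h⟩ := exists_parallelCoframe hσ hD p
  have hp' := mem_chart_source Plane p
  obtain ⟨t, ht⟩ := h.exists_curl_eq hT
  by_cases h0 : t = 0
  · have h' : AdaptedCoframe D 0 p s θ :=
      ⟨h, fun z hz ↦ by simp [ht z hz, h0], fun z hz ↦ by simp [ht z hz, h0]⟩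
    exact .inl ⟨_, h'.adaptedAt hp' hp⟩
  · have hdet : t 0 * t 0 - t 1 * -t 1 ≠ 0 := by
      intro he
      refine h0 (funext fun j ↦ ?_)
      have : t 0 ^ 2 + t 1 ^ 2 = 0 := by linear_combination he
      obtain ⟨e0, e1⟩ := (add_eq_zero_iff_of_nonneg (sq_nonneg _) (sq_nonneg _)).1 this
      fin_cases j
      · exact pow_eq_zero_iff two_ne_zero |>.1 e0
      · exact pow_eq_zero_iff two_ne_zero |>.1 e1
    -- The first new form is `t₀ θ₀ + t₁ θ₁`, whose derivative is `(t₀² + t₁²) θ₀ ∧ θ₁`. The second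
    -- is its rotation, whose derivative cancels. The determinant is also `t₀² + t₁²`, so the
    -- constant becomes exactly `1`.
    have h' := h.combination (a := ![![t 0, t 1], ![-t 1, t 0]]) (by simpa using hdet)
    have h'' : AdaptedCoframe D 1 p s
        fun z j ↦ ∑ l, ![![t 0, t 1], ![-t 1, t 0]] j l • θ z l := by
      refine ⟨h', fun z hz ↦ ?_, fun z hz ↦ ?_⟩
      · rw [curl_combination (h.differentiableAt_apply hz), wedge_combination, ht z hz, ht z hz]
        simp
        ring
      · rw [curl_combination (h.differentiableAt_apply hz), ht z hz, ht z hz]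
        simp
        ring
    exact .inr ⟨_, h''.adaptedAt hp' hp⟩

/-! ### Local equivalence with the models -/

/-- The coefficients `c_k e^{(4 - k) ε y}`. -/
def modelCoeffs (ε : ℝ) (c : Fin 5 → ℝ) (y : ℝ) (k : Fin 5) : ℝ :=
  Real.exp (ε * y) ^ (4 - k.val) * c k

lemma FourVector.coeffs_smul_left (S : FourVector Plane) (r : ℝ) (ξ η : PlaneDual) (k : Fin 5) :
    S.coeffs (r • ξ) η k = r ^ (4 - k.val) * S.coeffs ξ η k := by
  have h1 := S.coeffs_eq_slot ![r • ξ, η] k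
  have h2 := S.coeffs_eq_slot ![ξ, η] k
  simp only [Matrix.cons_val_zero, Matrix.cons_val_one] at h1 h2
  rw [h1, h2]
  have e : (fun i ↦ ![r • ξ, η] (slot k i))
      = fun i ↦ (![r, 1] (slot k i) : ℝ) • ![ξ, η] (slot k i) := by
    ext i : 1
    generalize slot k i = j
    fin_cases j <;> simp
  rw [e, MultilinearMap.map_smul_univ, smul_eq_mul]
  congr 1
  fin_cases k <;> simp [Fin.prod_univ_four, slot] <;> ring

lemma ofCoeffs_partialField (a : Fin 5 → ℝ) (z : Plane) :
    (FourVector.ofCoeffs a (partialField 0 z) (partialField 1 z)).coeffs (stdCovec 0) (stdCovec 1)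
      = a := by
  have h (i j : Fin 2) : stdCovec i (partialField j z) = if i = j then 1 else 0 := stdVec_apply j i
  exact FourVector.ofCoeffs_coeffs a ((h 0 0).trans (if_pos rfl)) ((h 0 1).trans (if_neg (by decide)))
    ((h 1 0).trans (if_neg (by decide))) ((h 1 1).trans (if_pos rfl))

lemma constantSymbol_coeffs (c : Fin 5 → ℝ) (z : Plane) :
    ((constantSymbol c).val z).coeffs (stdCovec 0) (stdCovec 1) = modelCoeffs 0 c (z 1) := by
  refine (ofCoeffs_partialField _ z).trans ?_
  ext k
  simp [modelCoeffs]

lemma exponentialSymbol_coeffs (c : Fin 5 → ℝ) (z : Plane) :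
    ((exponentialSymbol c).val z).coeffs (stdCovec 0) (stdCovec 1) = modelCoeffs 1 c (z 1) := by
  simp only [exponentialSymbol, Symbol.ofCoeffs, ofCoeffs_partialField]
  ext k
  fin_cases k <;> simp [modelCoeffs, ← Real.exp_nat_mul] <;> ring_nf

/-- Two functions of the chart coordinates with independent differentials are local coordinates. -/
lemma exists_localCoordinates {p₀ : M} {s : Set Plane} (hs : IsOpen s)
    (hp : chartAt Plane p₀ p₀ ∈ s) {f : Fin 2 → Plane → ℝ}
    (hf : ∀ i, ContDiffOn ℝ ∞ (f i) s)
    (hw : ∀ z ∈ s, wedge (fderiv ℝ (f 0) z) (fderiv ℝ (f 1) z) ≠ 0) :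
    ∃ φ : OpenPartialHomeomorph M Plane, p₀ ∈ φ.source ∧
      ContMDiffOn (𝓡 2) (𝓡 2) ∞ φ φ.source ∧ ContMDiffOn (𝓡 2) (𝓡 2) ∞ φ.symm φ.target ∧
      ∀ q ∈ φ.source, q ∈ (chartAt Plane p₀).source ∧ chartAt Plane p₀ q ∈ s ∧
        (∀ i, φ q i = f i (chartAt Plane p₀ q)) ∧
        ∀ i, (stdCovec i).comp (mfderiv (𝓡 2) (𝓡 2) φ q)
          = (fderiv ℝ (f i) (chartAt Plane p₀ q)).comp (chartDiff p₀ q) := by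
  let F : Plane → Plane := fun z ↦ WithLp.toLp 2 fun i ↦ f i z
  have hF : ContDiffOn ℝ ∞ F s := by
    rw [contDiffOn_euclidean]
    exact hf
  have hFd (z) (hz : z ∈ s) : DifferentiableAt ℝ F z :=
    (hF.contDiffAt (hs.mem_nhds hz)).differentiableAt (by simp)
  have hFf (z) (hz : z ∈ s) (i) : (stdCovec i).comp (fderiv ℝ F z) = fderiv ℝ (f i) z :=
    (((stdCovec i).hasFDerivAt.comp z (hFd z hz).hasFDerivAt).fderiv).symm
  have hinv (z) (hz : z ∈ s) : ∃ e : Plane ≃L[ℝ] Plane, HasFDerivAt F (e : Plane →L[ℝ] Plane) z := by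
    have hinj : Injective (fderiv ℝ F z : Plane →ₗ[ℝ] Plane) := by
      rw [← LinearMap.ker_eq_bot, Submodule.eq_bot_iff]
      intro v hv
      refine eq_zero_of_wedge_ne_zero (θ := fun i ↦ fderiv ℝ (f i) z) (hw z hz) fun j ↦ ?_
      rw [← hFf z hz j]
      have : fderiv ℝ F z v = 0 := hv
      simp [this]
    refine ⟨(LinearEquiv.ofInjectiveEndo _ hinj).toContinuousLinearEquiv, ?_⟩
    exact (hFd z hz).hasFDerivAt
  obtain ⟨e₀, he₀⟩ := hinv _ hp
  have hn : (∞ : ℕ∞ω) ≠ 0 := by simp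
  let ψ₀ := (hF.contDiffAt (hs.mem_nhds hp)).toOpenPartialHomeomorph F he₀ hn
  have hψ₀ : chartAt Plane p₀ p₀ ∈ ψ₀.source :=
    (hF.contDiffAt (hs.mem_nhds hp)).mem_toOpenPartialHomeomorph_source he₀ hn
  -- Inside `s` the differential of `F` is invertible at every point, not only at the base point, so
  -- the inverse is smooth on the whole target.
  let ψ := ψ₀.restrOpen s hs
  have hψs : ψ.source ⊆ s := fun z hz ↦ hz.2
  have hψF : ⇑ψ = F := rfl
  have hψsymm : ContDiffOn ℝ ∞ ψ.symm ψ.target := by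
    intro y hy
    have hys := ψ.map_target hy
    obtain ⟨e, he⟩ := hinv _ (hψs hys)
    exact (ψ.contDiffAt_symm hy he (hF.contDiffAt (hs.mem_nhds (hψs hys)))).contDiffWithinAt
  let φ := (chartAt Plane p₀).trans ψ
  have hφ (q) (hq : q ∈ φ.source) : q ∈ (chartAt Plane p₀).source ∧ chartAt Plane p₀ q ∈ ψ.source := by
    simpa [φ] using hq
  refine ⟨φ, ?_, ?_, ?_, fun q hq ↦ ⟨(hφ q hq).1, hψs (hφ q hq).2, fun i ↦ rfl, fun i ↦ ?_⟩⟩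
  · have : p₀ ∈ (chartAt Plane p₀).source ∧ chartAt Plane p₀ p₀ ∈ ψ.source :=
      ⟨mem_chart_source _ _, hψ₀, hp⟩
    simpa [φ] using this
  · intro q hq
    exact (ContMDiffAt.comp q
      (hF.contDiffAt (hs.mem_nhds (hψs (hφ q hq).2))).contMDiffAt
      (contMDiffAt_chart (hφ q hq).1)).contMDiffWithinAt
  · refine (contMDiffOn_chart_symm (I := 𝓡 2) (n := ∞) (x := p₀)).comp
      (hψsymm.contMDiffOn.mono ?_) ?_
    · intro y hy
      exact (show y ∈ ψ.target ∧ _ by simpa [φ, OpenPartialHomeomorph.trans_target] using hy).1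
    · intro y hy
      exact (show y ∈ ψ.target ∧ ψ.symm y ∈ (chartAt Plane p₀).target by
        simpa [φ, OpenPartialHomeomorph.trans_target] using hy).2
  · have hz := hψs (hφ q hq).2
    have h := mfderiv_comp (I := 𝓡 2) (I' := 𝓡 2) (I'' := 𝓡 2) q (hFd _ hz).mdifferentiableAt
      ((contMDiffAt_chart (hφ q hq).1).mdifferentiableAt (by simp))
    rw [mfderiv_eq_fderiv, ← chartDiff_eq_mfderiv (hφ q hq).1] at h
    rw [← hFf _ hz]
    ext v
    exact congr(stdCovec i ($h v))

/-- Integrating an adapted coframe gives coordinates with `dy = θ₁` and `dx = e^{εy} θ₀`. Rescaling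
`θ₀` multiplies the `k`-th constant coefficient by `e^{(4-k)εy}`. -/
lemma locallyEquivalent_of_adaptedAt {σ : Symbol M} (hσ : σ.IsRegular) {D : LinearConnection M}
    (hD : σ.IsWagnerConnection D) (hT : HasParallelTorsion D) {ε : ℝ} {c : Fin 5 → ℝ}
    (hc : ∀ p, AdaptedAt σ D ε c p) {τ : Symbol Plane}
    (hτ : ∀ z, (τ.val z).coeffs (stdCovec 0) (stdCovec 1) = modelCoeffs ε c (z 1)) :
    σ.LocallyEquivalent τ := by
  intro p
  obtain ⟨s, θ₀, hp, h₀⟩ := exists_parallelCoframe hσ hD p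
  obtain ⟨θ, h, hθc⟩ := (hc p).exists_adaptedCoframe hT h₀ (mem_chart_source Plane p) hp
  have hθ := contDiffOn_pi.1 h.contDiffOn
  obtain ⟨g, hg, hg'⟩ := exists_potential h.convex h.isOpen (hθ 1) h.curl_one
  have hgd (z) (hz : z ∈ s) : DifferentiableAt ℝ g z :=
    (hg.contDiffAt (h.isOpen.mem_nhds hz)).differentiableAt (by simp)
  have hed (z) (hz : z ∈ s) : HasFDerivAt (fun z ↦ Real.exp (ε * g z))
      (Real.exp (ε * g z) • (ε • θ z 1)) z := by
    rw [← hg' z hz]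
    exact ((hgd z hz).hasFDerivAt.const_mul ε).exp
  -- The integrating factor works because `d(e^{εg}) ∧ θ₀ = ε e^{εg} θ₁ ∧ θ₀` cancels `e^{εg} dθ₀ =
  -- ε e^{εg} θ₀ ∧ θ₁`.
  obtain ⟨f, hf, hf'⟩ := exists_potential (ν := fun z ↦ Real.exp (ε * g z) • θ z 0) h.convex h.isOpen
    ((hg.const_smul ε).exp.smul (hθ 0)) fun z hz ↦ by
      rw [curl_smul (hed z hz).differentiableAt (h.differentiableAt_apply hz 0), (hed z hz).fderiv,
        h.curl_zero z hz]
      simp [wedge]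
      ring
  obtain ⟨φ, hpφ, hφ, hφ', hφq⟩ := exists_localCoordinates h.isOpen hp
    (f := ![f, g]) (fun i ↦ by fin_cases i; exacts [hf, hg]) fun z hz ↦ by
      have := h.wedge_ne_zero z hz
      have hexp := (Real.exp_pos (ε * g z)).ne'
      have e : wedge (fderiv ℝ f z) (fderiv ℝ g z) = Real.exp (ε * g z) * wedge (θ z 0) (θ z 1) := by
        rw [hf' z hz, hg' z hz]
        simp [wedge]
        ring
      simpa [e] using this
  refine ⟨φ, hpφ, hφ, hφ', fun q hq α ↦ ?_⟩
  obtain ⟨hq1, hq2, hq3, hq4⟩ := hφq q hq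
  have hform := FourVector.form_eq_of_coeffs_eq (S := τ.val (φ q))
    (S' := (σ.val q).map (mfderiv (𝓡 2) (𝓡 2) φ q)) (θ := stdCovec)
    (by simp [FourVector.wedge_stdCovec]) (by
      have e0 := hq4 0
      have e1 := hq4 1
      have hcq := h.coeffs_const hD hq2 hp
      rw [hθc] at hcq
      refine (hτ (φ q)).trans (Eq.symm ((FourVector.map_coeffs _ _ _ _).trans ?_))
      refine (congrArg₂ (σ.val q).coeffs e0 e1).trans ?_
      refine (FourVector.map_coeffs (chartDiff p q) (σ.val q) _ _).symm.trans ?_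
      rw [← coordSymbol_chart σ hq1]
      simp only [Matrix.cons_val_zero, Matrix.cons_val_one]
      rw [hf' _ hq2, hg' _ hq2]
      ext k
      rw [FourVector.coeffs_smul_left, hcq, modelCoeffs]
      have : φ q 1 = g (chartAt Plane p q) := hq3 1
      rw [this])
  exact congr($hform α)

/-- The pull-backs of `e^{-εy} dx` and `dy` give `σ` the constant coefficients `c`, so rigidity
makes them parallel for the given connection. Closedness of `dx` and `dy` yields the structure
equations. -/
lemma exists_adaptedCoframe_of_locallyEquivalent {σ : Symbol M} (hσ : σ.IsRegular)
    {D : LinearConnection M} (hD : σ.IsWagnerConnection D) {ε : ℝ} {c : Fin 5 → ℝ}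
    {τ : Symbol Plane}
    (hτ : ∀ z, (τ.val z).coeffs (stdCovec 0) (stdCovec 1) = modelCoeffs ε c (z 1))
    (h : σ.LocallyEquivalent τ) (p : M) :
    ∃ s θ, chartAt Plane p p ∈ s ∧ AdaptedCoframe D ε p s θ := by
  obtain ⟨φ, hp, hφ, hφ', hform⟩ := h p
  let κ := chartAt Plane p
  have hκp : p ∈ κ.source := mem_chart_source Plane p
  have hs₀ : IsOpen (κ.target ∩ κ.symm ⁻¹' φ.source) := κ.symm.isOpen_inter_preimage φ.open_source
  have hp₀ : κ p ∈ κ.target ∩ κ.symm ⁻¹' φ.source :=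
    ⟨κ.map_source hκp, by rwa [mem_preimage, κ.left_inv hκp]⟩
  obtain ⟨r, hr, hball⟩ := Metric.isOpen_iff.1 hs₀ _ hp₀
  let f (i : Fin 2) (z : Plane) : ℝ := φ (κ.symm z) i
  have hf (i) : ContDiffOn ℝ ∞ (f i) (Metric.ball (κ p) r) := by
    have h1 : ContMDiffOn (𝓡 2) (𝓡 2) ∞ (φ ∘ κ.symm) (Metric.ball (κ p) r) :=
      hφ.comp ((contMDiffOn_chart_symm (I := 𝓡 2) (n := ∞) (x := p)).mono
        fun z hz ↦ (hball hz).1) fun z hz ↦ (hball hz).2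
    exact contDiffOn_euclidean.1 (contMDiffOn_iff_contDiffOn.1 h1) i
  have hfat (i) {z} (hz : z ∈ Metric.ball (κ p) r) : ContDiffAt ℝ ∞ (f i) z :=
    (hf i).contDiffAt (Metric.isOpen_ball.mem_nhds hz)
  have hd (q) (hq : q ∈ κ.source) (hqs : κ q ∈ Metric.ball (κ p) r) (i) :
      (stdCovec i).comp (mfderiv (𝓡 2) (𝓡 2) φ q) = (fderiv ℝ (f i) (κ q)).comp (chartDiff p q) := by
    have hqφ : q ∈ φ.source := by
      have := (hball hqs).2
      rwa [mem_preimage, κ.left_inv hq] at this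
    have h1 := mfderiv_comp (I := 𝓡 2) (I' := 𝓡 2) (I'' := 𝓘(ℝ, ℝ)) q
      ((stdCovec i).differentiableAt (x := φ q)).mdifferentiableAt
      ((hφ.contMDiffAt (φ.open_source.mem_nhds hqφ)).mdifferentiableAt (by simp))
    have h2 := mfderiv_comp (I := 𝓡 2) (I' := 𝓡 2) (I'' := 𝓘(ℝ, ℝ)) q
      ((hfat i hqs).differentiableAt (by simp)).mdifferentiableAt
      ((contMDiffAt_chart hq).mdifferentiableAt (by simp))
    have e : (stdCovec i ∘ φ : M → ℝ) =ᶠ[𝓝 q] f i ∘ κ := by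
      filter_upwards [κ.open_source.mem_nhds hq] with q' hq'
      simp [f, κ.left_inv hq']
    rw [e.mfderiv_eq, h2, mfderiv_eq_fderiv, mfderiv_eq_fderiv] at h1
    rw [chartDiff_eq_mfderiv hq]
    refine Eq.trans ?_ h1.symm
    rw [(stdCovec i).fderiv]
    rfl
  have hqφ (q) (hq : q ∈ κ.source) (hqs : κ q ∈ Metric.ball (κ p) r) : q ∈ φ.source := by
    have := (hball hqs).2
    rwa [mem_preimage, κ.left_inv hq] at this
  have hw (q) (hq : q ∈ κ.source) (hqs : κ q ∈ Metric.ball (κ p) r) :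
      wedge (fderiv ℝ (f 0) (κ q)) (fderiv ℝ (f 1) (κ q)) ≠ 0 := by
    have hφd : φ.MDifferentiable (𝓡 2) (𝓡 2) :=
      ⟨hφ.mdifferentiableOn (by simp), hφ'.mdifferentiableOn (by simp)⟩
    have hinj := hφd.mfderiv_injective (hqφ q hq hqs)
    refine wedge_ne_zero_of_forall (θ := fun i ↦ fderiv ℝ (f i) (κ q)) fun v hv ↦ ?_
    have h0 : mfderiv (𝓡 2) (𝓡 2) φ q (chartDiffSymm p q v) = 0 := by
      refine PiLp.ext fun i ↦ ?_
      have := congr($(hd q hq hqs i) (chartDiffSymm p q v))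
      refine this.trans ((congrArg (fderiv ℝ (f i) (κ q)) (chartDiff_chartDiffSymm hq v)).trans
        (hv i))
    rw [← chartDiff_chartDiffSymm hq v, hinj (h0.trans (map_zero _).symm), map_zero]
  have hcoef (q) (hq : q ∈ κ.source) (hqs : κ q ∈ Metric.ball (κ p) r) :
      (coordSymbol σ p (κ q)).coeffs (fderiv ℝ (f 0) (κ q)) (fderiv ℝ (f 1) (κ q))
        = modelCoeffs ε c (f 1 (κ q)) := by
    have hf1 : f 1 (κ q) = φ q 1 := by simp only [f, κ.left_inv hq]
    rw [coordSymbol_chart σ hq, FourVector.map_coeffs, ← hd q hq hqs, ← hd q hq hqs, hf1, ← hτ]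
    ext k
    refine ((σ.val q).coeffs_eq_slot
      (fun i ↦ (stdCovec i).comp (mfderiv (𝓡 2) (𝓡 2) φ q)) k).trans
      (Eq.trans ?_ ((τ.val (φ q)).coeffs_eq_slot stdCovec k).symm)
    exact (hform q (hqφ q hq hqs) _).symm
  -- The factor `e^{-εy}` on `dx` cancels the exponentials in `modelCoeffs`, since the `k`-th
  -- coefficient is homogeneous of degree `4 - k` in the first covector.
  let θ (z : Plane) : Fin 2 → PlaneDual :=
    ![Real.exp (-(ε * f 1 z)) • fderiv ℝ (f 0) z, fderiv ℝ (f 1) z]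
  have hθ (z) (hz : z ∈ Metric.ball (κ p) r) : ContDiffAt ℝ ∞ θ z := by
    rw [contDiffAt_pi]
    intro i
    have hfi (i) := (hfat i hz).fderiv_right (m := ∞) (by simp)
    fin_cases i
    · exact ((hfat 1 hz).const_smul ε).neg.exp.smul (hfi 0)
    · exact hfi 1
  have hball' (z) (hz : z ∈ Metric.ball (κ p) r) : κ.symm z ∈ κ.source ∧ κ (κ.symm z) = z :=
    ⟨κ.map_target (hball hz).1, κ.right_inv (hball hz).1⟩
  have hθw (z) : wedge (θ z 0) (θ z 1)
      = Real.exp (-(ε * f 1 z)) * wedge (fderiv ℝ (f 0) z) (fderiv ℝ (f 1) z) := by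
    simp [θ, wedge]
    ring
  have hθc (z) (hz : z ∈ Metric.ball (κ p) r) :
      (coordSymbol σ p z).coeffs (θ z 0) (θ z 1) = c := by
    have h1 := hcoef (κ.symm z) (hball' z hz).1 (by rwa [(hball' z hz).2])
    rw [(hball' z hz).2] at h1
    ext k
    refine (FourVector.coeffs_smul_left _ _ (fderiv ℝ (f 0) z) (fderiv ℝ (f 1) z) k).trans ?_
    rw [h1, modelCoeffs, ← mul_assoc, ← mul_pow, ← Real.exp_add, neg_add_cancel, Real.exp_zero,
      one_pow, one_mul]
  refine ⟨Metric.ball (κ p) r, θ, Metric.mem_ball_self hr, ⟨Metric.isOpen_ball, convex_ball _ _,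
    fun z hz ↦ (hball hz).1, fun z hz ↦ (hθ z hz).contDiffWithinAt, fun z hz ↦ ?_,
    fun q hq hqs ↦ ?_⟩, fun z hz ↦ ?_, fun z hz ↦ ?_⟩
  · have h1 := hw (κ.symm z) (hball' z hz).1 (by rwa [(hball' z hz).2])
    rw [(hball' z hz).2] at h1
    rw [hθw]
    exact mul_ne_zero (Real.exp_pos _).ne' h1
  · have e : (fun z ↦ (coordSymbol σ p z).coeffs (θ z 0) (θ z 1)) =ᶠ[𝓝 (κ q)] fun _ ↦ c := by
      filter_upwards [Metric.isOpen_ball.mem_nhds hqs] with z hz using hθc z hz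
    refine parallelAt_of_fderiv_coeffs_eq_zero hD hq ((hθ _ hqs).differentiableAt (by simp))
      ((differentiableAt_const c).congr_of_eventuallyEq e) (.id ℝ _) (fun θ' h0 ↦ ?_) ?_
    · refine FourVector.eq_zero_of_coeffsDeriv_eq_zero (coordSymbol_isRegular hσ hq) ?_ h0
      change wedge (θ (κ q) 0) (θ (κ q) 1) ≠ 0
      rw [hθw]
      exact mul_ne_zero (Real.exp_pos _).ne' (hw q hq hqs)
    · exact e.fderiv_eq.trans (by simp)
  · have he : HasFDerivAt (fun z ↦ Real.exp (-(ε * f 1 z)))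
        (Real.exp (-(ε * f 1 z)) • -(ε • fderiv ℝ (f 1) z)) z :=
      ((((hfat 1 hz).differentiableAt (by simp)).hasFDerivAt.const_mul ε).neg).exp
    have hfd := ((hfat 0 hz).fderiv_right (m := ∞) (by simp)).differentiableAt (by simp)
    refine (curl_smul he.differentiableAt hfd).trans ?_
    rw [he.fderiv, curl_fderiv (hfat 0 hz), hθw]
    simp [wedge]
    ring
  · exact curl_fderiv (hfat 1 hz)

lemma torsion_ne_zero_of_adaptedCoframe {D : LinearConnection M} {p : M} {s : Set Plane}
    {θ : Plane → Fin 2 → PlaneDual} (h : AdaptedCoframe D 1 p s θ) (hp : chartAt Plane p p ∈ s) :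
    D.torsion p ≠ 0 := by
  intro h0
  have h1 := (h.torsion_eq_zero_iff (mem_chart_source Plane p) hp).1 h0 0
  rw [h.curl_zero _ hp, one_mul] at h1
  exact h.wedge_ne_zero _ hp h1

lemma torsion_eq_zero_of_adaptedCoframe {D : LinearConnection M} {p : M} {s : Set Plane}
    {θ : Plane → Fin 2 → PlaneDual} (h : AdaptedCoframe D 0 p s θ) (hp : chartAt Plane p p ∈ s) :
    D.torsion p = 0 := by
  refine (h.torsion_eq_zero_iff (mem_chart_source Plane p) hp).2 fun j ↦ ?_
  fin_cases j
  · exact (h.curl_zero _ hp).trans (zero_mul _)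
  · exact h.curl_one _ hp

end QuarticSymbol

end

theorem mainTheorem3 {M : Type*} [TopologicalSpace M] [T2Space M] [ConnectedSpace M]
    [ChartedSpace QuarticSymbol.Plane M] [IsManifold (𝓡 2) ∞ M]
    (σ : QuarticSymbol.Symbol M) (hσ : σ.IsRegular)
    (D : QuarticSymbol.LinearConnection M) [D.ContMDiffCovariantDerivative ∞]
    (hD : σ.IsWagnerConnection D) (hT : QuarticSymbol.HasParallelTorsion D) :
    ((∃ c : Fin 5 → ℝ, σ.LocallyEquivalent (QuarticSymbol.constantSymbol c)) ↔ D.torsion = 0) ∧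
    ((∃ c : Fin 5 → ℝ, σ.LocallyEquivalent (QuarticSymbol.exponentialSymbol c)) ↔
      D.torsion ≠ 0) := by
  obtain ⟨p₀⟩ : Nonempty M := inferInstance
  have hconst (c) (h : σ.LocallyEquivalent (QuarticSymbol.constantSymbol c)) : D.torsion = 0 := by
    funext p
    obtain ⟨s, θ, hp, hθ⟩ := QuarticSymbol.exists_adaptedCoframe_of_locallyEquivalent hσ hD
      (QuarticSymbol.constantSymbol_coeffs c) h p
    exact QuarticSymbol.torsion_eq_zero_of_adaptedCoframe hθ hp
  have hexp (c) (h : σ.LocallyEquivalent (QuarticSymbol.exponentialSymbol c)) :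
      D.torsion ≠ 0 := by
    obtain ⟨s, θ, hp, hθ⟩ := QuarticSymbol.exists_adaptedCoframe_of_locallyEquivalent hσ hD
      (QuarticSymbol.exponentialSymbol_coeffs c) h p₀
    exact fun h0 ↦ QuarticSymbol.torsion_ne_zero_of_adaptedCoframe hθ hp (congrFun h0 p₀)
  have hor : (∃ c, σ.LocallyEquivalent (QuarticSymbol.constantSymbol c)) ∨
      ∃ c, σ.LocallyEquivalent (QuarticSymbol.exponentialSymbol c) := by
    rcases QuarticSymbol.exists_adaptedAt hσ hD hT p₀ with ⟨c, hc⟩ | ⟨c, hc⟩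
    · exact .inl ⟨c, QuarticSymbol.locallyEquivalent_of_adaptedAt hσ hD hT
        (QuarticSymbol.adaptedAt_of_preconnectedSpace hσ hD hT hc)
        (QuarticSymbol.constantSymbol_coeffs c)⟩
    · exact .inr ⟨c, QuarticSymbol.locallyEquivalent_of_adaptedAt hσ hD hT
        (QuarticSymbol.adaptedAt_of_preconnectedSpace hσ hD hT hc)
        (QuarticSymbol.exponentialSymbol_coeffs c)⟩
  -- One of the two models always occurs, and the torsion tells them apart, so each reverse
  -- implication holds by excluding the other model.
  refine ⟨⟨fun ⟨c, hc⟩ ↦ hconst c hc, fun h0 ↦ hor.resolve_right fun ⟨c, hc⟩ ↦ hexp c hc h0⟩,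
    ⟨fun ⟨c, hc⟩ ↦ hexp c hc, fun h0 ↦ hor.resolve_left fun ⟨c, hc⟩ ↦ h0 (hconst c hc)⟩⟩
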